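/- Manifolds are smooth ($C^\infty$), connected, Hausdorff, second countable and without boundary. Let $(\overline M,\overline g)$ be a compact Riemannian manifold of dimension $m$, let $(\Sigma,\eta)$ be a Riemannian manifold of dimension $p\ge1$, and let $\phi:\overline M\to(0,\infty)$ be a nonconstant smooth function. Suppose that the warped product $$(M,g)=(\overline M\times\Sigma,\ \overline g+\phi^2\eta),$$ of dimension $n=m+p$, has harmonic curvature, that is, its curvature tensor $R$ satisfies $\operatorname{div}R=0$ (in local coordinates, $R_{ijl}{}^k{}_{,k}=0$). Then: 1. the fibre $(\Sigma,\eta)$ is an Einstein manifold, that is, its Ricci tensor equals $\kappa\,\eta$ for some constant $\kappa\in\mathbb R$, and its Einstein constant $\kappa$ is positive; 2. consequently $p=\dim\Sigma>1$; 3. there is no point of $M$ at which the Ricci tensor of $g$ (viewed, through $g$, as an endomorphism of the tangent space) has $n$ distinct eigenvalues. -/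

import Mathlib

open scoped Manifold ContDiff

noncomputable section

/-! Smooth manifolds are Mathlib manifolds modelled on a finite-dimensional real vector space `E`
with a chosen basis `b`; the basis turns each chart into a local coordinate system `(y^i)`.
Curvature is computed in local coordinates by the classical index formulas. -/

namespace RiemCoord

variable {E : Type*} [NormedAddCommGroup E] [NormedSpace ℝ E] {ι : Type*}

/-- The partial derivative `∂_i f` at `y`, in the linear coordinates of `E` given by `b`. -/
def pd (b : Module.Basis ι ℝ E) (i : ι) (f : E → ℝ) (y : E) : ℝ :=
  fderiv ℝ f y (b i)

variable [Fintype ι] [DecidableEq ι]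

/-- The Christoffel symbol
`Γ_{ij}^k = 1/2 ∑_l g^{kl} (∂_i g_{jl} + ∂_j g_{il} - ∂_l g_{ij})`
of a matrix of metric components `G = (g_{ij})`, as a function of the coordinates. -/
def christoffel (b : Module.Basis ι ℝ E) (G : E → Matrix ι ι ℝ) (i j k : ι) (y : E) : ℝ :=
  (1 / 2 : ℝ) * ∑ l, (G y)⁻¹ k l *
    (pd b i (fun z => G z j l) y + pd b j (fun z => G z i l) y - pd b l (fun z => G z i j) y)

/-- The components `R_{ijl}^k` of the curvature tensor, that is, the `∂_k`-component of
`∇_j ∇_i ∂_l - ∇_i ∇_j ∂_l`. -/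
def curvature (b : Module.Basis ι ℝ E) (G : E → Matrix ι ι ℝ) (i j l k : ι) (y : E) : ℝ :=
  pd b j (christoffel b G i l k) y - pd b i (christoffel b G j l k) y
    + ∑ q, (christoffel b G j q k y * christoffel b G i l q y
        - christoffel b G i q k y * christoffel b G j l q y)

/-- The components `R_{jk} = ∑_q R_{jqk}^q` of the Ricci tensor. -/
def ricci (b : Module.Basis ι ℝ E) (G : E → Matrix ι ι ℝ) (j k : ι) (y : E) : ℝ :=
  ∑ q, curvature b G j q k q y

/-- The matrix `(∑_l g^{il} R_{lj})` of the Ricci endomorphism (`i` is the row). -/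
def ricciEndo (b : Module.Basis ι ℝ E) (G : E → Matrix ι ι ℝ) (y : E) : Matrix ι ι ℝ :=
  (G y)⁻¹ * Matrix.of fun l j => ricci b G l j y

/-- The components `(div R)_{ijl} = ∑_k R_{ijl}^k_{,k}` of the divergence of the curvature tensor,
the comma denoting covariant differentiation. -/
def divCurvature (b : Module.Basis ι ℝ E) (G : E → Matrix ι ι ℝ) (i j l : ι) (y : E) : ℝ :=
  ∑ k, (pd b k (curvature b G i j l k) y
    + ∑ q, (christoffel b G k q k y * curvature b G i j l q y
        - christoffel b G k i q y * curvature b G q j l k y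
        - christoffel b G k j q y * curvature b G i q l k y
        - christoffel b G k l q y * curvature b G i j q k y))

end RiemCoord

section Manifold

variable {E : Type*} [NormedAddCommGroup E] [NormedSpace ℝ E]
  {H : Type*} [TopologicalSpace H] (I : ModelWithCorners ℝ E H)
  {M : Type*} [TopologicalSpace M] [ChartedSpace H M]

/-- A twice-covariant (not necessarily continuous) tensor field, given by its values on pairs of
tangent vectors. Below it is always a Riemannian metric. -/
abbrev TwoTensor (M : Type*) [TopologicalSpace M] [ChartedSpace H M] : Type _ :=
  (x : M) → TangentSpace I x → TangentSpace I x → ℝ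

/-- The components `g_{ij} = g(∂_i, ∂_j)` of `g` in the chart around `x₀`, as functions on the
image of the chart, where `∂_i` are the coordinate vector fields. -/
def metricComponents {ι : Type*} (b : Module.Basis ι ℝ E) (g : TwoTensor I M) (x₀ : M) (y : E) :
    Matrix ι ι ℝ :=
  Matrix.of fun i j =>
    g ((extChartAt I x₀).symm y)
      (mfderiv 𝓘(ℝ, E) I (extChartAt I x₀).symm y (b i))
      (mfderiv 𝓘(ℝ, E) I (extChartAt I x₀).symm y (b j))

variable {ι : Type*} [Fintype ι] [DecidableEq ι] (b : Module.Basis ι ℝ E)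

/-- The metric `g` has harmonic curvature: `div R = 0`, i.e. `R_{ijl}^k_{,k} = 0` at all points
of the charts. -/
def HasHarmonicCurvature (g : TwoTensor I M) : Prop :=
  ∀ x₀ : M, ∀ y ∈ (extChartAt I x₀).target, ∀ i j l : ι,
    RiemCoord.divCurvature b (metricComponents I b g x₀) i j l y = 0

/-- `g` is an Einstein metric with Einstein constant `κ`: its Ricci tensor equals `κ g`. -/
def IsEinsteinWith (g : TwoTensor I M) (κ : ℝ) : Prop :=
  ∀ x₀ : M, ∀ y ∈ (extChartAt I x₀).target, ∀ i j : ι,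
    RiemCoord.ricci b (metricComponents I b g x₀) i j y
      = κ * metricComponents I b g x₀ y i j

/-- The set of the (real) eigenvalues at `x` of the Ricci tensor of `g`, i.e. of the Ricci
endomorphism of the tangent space, here computed in the chart around `x`. -/
def ricciEigenvalues (g : TwoTensor I M) (x : M) : Set ℝ :=
  {μ | Module.End.HasEigenvalue (Matrix.toLin'
    (RiemCoord.ricciEndo b (metricComponents I b g x) (extChartAt I x x))) μ}

end Manifold

section Warped

variable {E E' : Type*} [NormedAddCommGroup E] [NormedSpace ℝ E]
  [NormedAddCommGroup E'] [NormedSpace ℝ E']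
  {H H' : Type*} [TopologicalSpace H] [TopologicalSpace H']
  (I : ModelWithCorners ℝ E H) (J : ModelWithCorners ℝ E' H')
  {B : Type*} [TopologicalSpace B] [ChartedSpace H B]
  {S : Type*} [TopologicalSpace S] [ChartedSpace H' S]

/-- The warped product metric `g_B + φ² g_S` on `B × S`, with `g_B`, `g_S` and `φ` pulled back
to the product by the projections. -/
def warpedMetric (gB : TwoTensor I B) (gS : TwoTensor J S) (φ : B → ℝ) :
    TwoTensor (I.prod J) (B × S) := fun x u v =>
  gB x.1 (mfderiv (I.prod J) I Prod.fst x u) (mfderiv (I.prod J) I Prod.fst x v)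
    + φ x.1 ^ 2 *
      gS x.2 (mfderiv (I.prod J) J Prod.snd x u) (mfderiv (I.prod J) J Prod.snd x v)

end Warped

/-- A smooth Riemannian metric on a manifold modelled on `ℝⁿ`. -/
abbrev SmoothMetric (n : ℕ) (M : Type*) [TopologicalSpace M]
    [ChartedSpace (EuclideanSpace ℝ (Fin n)) M] [IsManifold (𝓡 n) ∞ M] : Type _ :=
  Bundle.ContMDiffRiemannianMetric (𝓡 n) ∞ (EuclideanSpace ℝ (Fin n))
    (fun x : M => TangentSpace (𝓡 n) x)

/-- The metric as a function of pairs of tangent vectors. -/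
def SmoothMetric.tensor {n : ℕ} {M : Type*} [TopologicalSpace M]
    [ChartedSpace (EuclideanSpace ℝ (Fin n)) M] [IsManifold (𝓡 n) ∞ M]
    (g : SmoothMetric n M) : TwoTensor (𝓡 n) M := fun x u v => g.inner x u v

/-- The standard basis of `ℝⁿ`. -/
abbrev stdBasis (n : ℕ) : Module.Basis (Fin n) ℝ (EuclideanSpace ℝ (Fin n)) :=
  (EuclideanSpace.basisFun (Fin n) ℝ).toBasis

end

/-! Write `f` for the warping function in a chart, `H` for its Hessian and `Q = |∇f|²`. Everything
rests on one component of `div R`, with one base index `a` and two fibre indices `i j`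
(`IsWarpedOn.divCurvature_lrr`): it equals `P_a N_ij + (f_a / f) Ric^N_ij`, where `N` is the fibre
metric and `P_a = f (div H)_a + (p - 2) (H∇f)_a - (p - 1) Q f_a / f` depends on the base point only.
If `div R = 0`, the variables separate. Fixing a base point and an index with `f_a ≠ 0`, which exist
because `φ` is nonconstant on a connected base, makes `Ric^N` a constant multiple of `N`, so the
fibre is Einstein.

With the Einstein constant `κ` inserted, the base carries the equation `P_a + κ f_a / f = 0`.
Suppose `κ ≤ 0`. The maximum principle is applied to `v = Q + ε f³`
(`IsMetricOn.gradSq_le_of_isLocalMax`). At a maximum `∇v = 0` determines `⟨∇f, H∇f⟩`, the equation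
bounds `⟨∇f, div H⟩` from below, and `Δv ≤ 0` together with Bochner's formula gives `Q ≤ m ε f³`
there. On a compact base this bounds `Q` everywhere by a fixed multiple of `ε`; letting `ε → 0`
makes `φ` constant, a contradiction (`eq_of_divHess_eq`). No curvature of the base enters, since
`div H` is never rewritten through the gradient of the Laplacian.

A one-dimensional fibre has zero Ricci tensor, so `κ > 0` forces `p > 1`. Finally, the Einstein
condition makes the fibre block of the Ricci endomorphism scalar, and one off-diagonal block
vanishes, so there are at most `m + 1 < m + p` eigenvalues. -/

noncomputable section

namespace RiemCoord

/-! ### Partial derivatives in linear coordinates -/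

section PartialDerivatives

variable {E : Type*} [NormedAddCommGroup E] [NormedSpace ℝ E] {ι : Type*}
  {b : Module.Basis ι ℝ E} {i : ι} {f g : E → ℝ} {y : E} {U : Set E}

theorem pd_congr (hU : IsOpen U) (h : Set.EqOn f g U) (hy : y ∈ U) : pd b i f y = pd b i g y := by
  unfold pd
  rw [(h.eventuallyEq_of_mem (hU.mem_nhds hy)).fderiv_eq]

@[simp] theorem pd_const (c : ℝ) : pd b i (fun _ => c) y = 0 := by
  simp [pd]

theorem pd_add (hf : DifferentiableAt ℝ f y) (hg : DifferentiableAt ℝ g y) :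
    pd b i (fun z => f z + g z) y = pd b i f y + pd b i g y := by
  simp [pd, fderiv_fun_add hf hg]

theorem pd_neg : pd b i (fun z => - f z) y = - pd b i f y := by
  simp [pd, fderiv_fun_neg]

theorem pd_mul (hf : DifferentiableAt ℝ f y) (hg : DifferentiableAt ℝ g y) :
    pd b i (fun z => f z * g z) y = pd b i f y * g y + f y * pd b i g y := by
  simp [pd, fderiv_fun_mul hf hg]
  ring

theorem pd_div (hf : DifferentiableAt ℝ f y) (hg : DifferentiableAt ℝ g y) (h0 : g y ≠ 0) :
    pd b i (fun z => f z / g z) y = (pd b i f y * g y - f y * pd b i g y) / g y ^ 2 := by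
  have hinv := (hasDerivAt_inv h0).comp_hasFDerivAt y hg.hasFDerivAt
  have := (hf.hasFDerivAt.mul hinv).fderiv
  simp only [div_eq_mul_inv]
  unfold pd
  rw [show (fun z => f z * (g z)⁻¹) = f * ((fun x => x⁻¹) ∘ g) from rfl, this]
  simp
  field_simp
  ring

theorem pd_sum {κ : Type*} {s : Finset κ} {F : κ → E → ℝ}
    (hF : ∀ k ∈ s, DifferentiableAt ℝ (F k) y) :
    pd b i (fun z => ∑ k ∈ s, F k z) y = ∑ k ∈ s, pd b i (F k) y := by
  simp [pd, fderiv_fun_sum hF]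

theorem contDiffOn_pd (hU : IsOpen U) (hf : ContDiffOn ℝ ∞ f U) :
    ContDiffOn ℝ ∞ (pd b i f) U :=
  (hf.fderiv_of_isOpen hU (by simp)).clm_apply contDiffOn_const

theorem differentiableAt_of_contDiffOn (hU : IsOpen U) (hf : ContDiffOn ℝ ∞ f U) (hy : y ∈ U) :
    DifferentiableAt ℝ f y :=
  (hf.contDiffAt (hU.mem_nhds hy)).differentiableAt (by simp)

theorem pd_pd_eq (hU : IsOpen U) (hf : ContDiffOn ℝ ∞ f U) (hy : y ∈ U) (j : ι) :
    pd b i (pd b j f) y = fderiv ℝ (fderiv ℝ f) y (b i) (b j) := by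
  have hd : DifferentiableAt ℝ (fderiv ℝ f) y :=
    ((hf.fderiv_of_isOpen hU (m := ∞) (by simp)).contDiffAt (hU.mem_nhds hy)).differentiableAt
      (by simp)
  have : fderiv ℝ (fun z => fderiv ℝ f z (b j)) y = (fderiv ℝ (fderiv ℝ f) y).flip (b j) := by
    rw [fderiv_clm_apply hd (by fun_prop)]
    simp
  unfold pd
  rw [this]; rfl

theorem pd_pd_comm (hU : IsOpen U) (hf : ContDiffOn ℝ ∞ f U) (hy : y ∈ U) (j : ι) :
    pd b i (pd b j f) y = pd b j (pd b i f) y := by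
  have hs : IsSymmSndFDerivAt ℝ f y := (hf.contDiffAt (hU.mem_nhds hy)).isSymmSndFDerivAt
    (by simpa using WithTop.coe_le_coe.2 (le_top (a := (2 : ℕ∞))))
  rw [pd_pd_eq hU hf hy, pd_pd_eq hU hf hy, hs]

end PartialDerivatives

/-! ### Smoothness of determinants and inverses of matrix fields -/

section MatrixFields

variable {E : Type*} [NormedAddCommGroup E] [NormedSpace ℝ E] {ι : Type*} [Fintype ι]
  [DecidableEq ι] {U : Set E}

theorem contDiffOn_det {A : E → Matrix ι ι ℝ} (hA : ∀ i j, ContDiffOn ℝ ∞ (fun y => A y i j) U) :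
    ContDiffOn ℝ ∞ (fun y => (A y).det) U := by
  simp only [Matrix.det_apply]
  refine ContDiffOn.sum fun σ _ => ?_
  exact (contDiffOn_prod fun i _ => hA (σ i) i).const_smul (Equiv.Perm.sign σ)

theorem contDiffOn_inv {A : E → Matrix ι ι ℝ} (hA : ∀ i j, ContDiffOn ℝ ∞ (fun y => A y i j) U)
    (h0 : ∀ y ∈ U, (A y).det ≠ 0) (i j : ι) :
    ContDiffOn ℝ ∞ (fun y => (A y)⁻¹ i j) U := by
  simp only [Matrix.inv_def, Matrix.smul_apply, smul_eq_mul, Ring.inverse_eq_inv',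
    Matrix.adjugate_apply]
  refine ((contDiffOn_det hA).inv h0).mul (contDiffOn_det fun k l => ?_)
  by_cases hk : k = j
  · subst hk; simpa using contDiffOn_const
  · simpa [Matrix.updateRow_ne hk] using hA k l

end MatrixFields

/-- `G` is the component matrix of a smooth Riemannian metric on the open set `U`. -/
structure IsMetricOn {E : Type*} [NormedAddCommGroup E] [NormedSpace ℝ E] {ι : Type*} [Fintype ι]
    (G : E → Matrix ι ι ℝ) (U : Set E) : Prop where
  isOpen : IsOpen U
  smooth : ∀ i j, ContDiffOn ℝ ∞ (fun y => G y i j) U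
  posDef : ∀ y ∈ U, (G y).PosDef

/-! ### Gradient and Hessian calculus in one coordinate patch -/

section Hessian

variable {E : Type*} [NormedAddCommGroup E] [NormedSpace ℝ E] {ι : Type*} [Fintype ι]
  [DecidableEq ι] (b : Module.Basis ι ℝ E) (G : E → Matrix ι ι ℝ) (f : E → ℝ)

/-- The components `f^k` of the gradient of `f`. -/
def grad (k : ι) (y : E) : ℝ := ∑ l, (G y)⁻¹ k l * pd b l f y

/-- The squared length of the gradient of `f`. -/
def gradSq (y : E) : ℝ := ∑ k, grad b G f k y * pd b k f y

/-- The components `f_{,a}^c` of the Hessian of `f`, as the covariant derivative of the gradient. -/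
def hessEndo (a c : ι) (y : E) : ℝ :=
  pd b a (grad b G f c) y + ∑ d, christoffel b G a d c y * grad b G f d y

/-- The components `f_{,ac}` of the Hessian of `f`. -/
def hess (a c : ι) (y : E) : ℝ :=
  pd b a (pd b c f) y - ∑ d, christoffel b G a c d y * pd b d f y

/-- The divergence `f_{,a}^c_{,c}` of the Hessian of `f`. -/
def divHess (a : ι) (y : E) : ℝ :=
  ∑ c, (pd b c (hessEndo b G f a c) y
    + ∑ d, (christoffel b G c d c y * hessEndo b G f a d y
      - christoffel b G c a d y * hessEndo b G f d c y))

end Hessian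

namespace IsMetricOn

variable {E : Type*} [NormedAddCommGroup E] [NormedSpace ℝ E] {ι : Type*} [Fintype ι]
  {b : Module.Basis ι ℝ E} {G : E → Matrix ι ι ℝ} {U : Set E} {f : E → ℝ}
  {y : E}

theorem symm_apply (hG : IsMetricOn G U) (hy : y ∈ U) (i j : ι) : G y i j = G y j i := by
  simpa using (hG.posDef y hy).isHermitian.apply j i

theorem pd_symm (hG : IsMetricOn G U) (hy : y ∈ U) (k i j : ι) :
    pd b k (fun z => G z i j) y = pd b k (fun z => G z j i) y :=
  pd_congr hG.isOpen (fun _ hz => hG.symm_apply hz i j) hy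

variable [DecidableEq ι]

theorem det_ne_zero (hG : IsMetricOn G U) (hy : y ∈ U) : (G y).det ≠ 0 :=
  (hG.posDef y hy).det_pos.ne'

theorem inv_mul (hG : IsMetricOn G U) (hy : y ∈ U) : (G y)⁻¹ * G y = 1 :=
  Matrix.nonsing_inv_mul _ (isUnit_iff_ne_zero.mpr (hG.det_ne_zero hy))

theorem mul_inv (hG : IsMetricOn G U) (hy : y ∈ U) : G y * (G y)⁻¹ = 1 :=
  Matrix.mul_nonsing_inv _ (isUnit_iff_ne_zero.mpr (hG.det_ne_zero hy))

theorem inv_symm_apply (hG : IsMetricOn G U) (hy : y ∈ U) (i j : ι) :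
    (G y)⁻¹ i j = (G y)⁻¹ j i := by
  simpa using (hG.posDef y hy).inv.isHermitian.apply j i

theorem smooth_inv (hG : IsMetricOn G U) (i j : ι) :
    ContDiffOn ℝ ∞ (fun y => (G y)⁻¹ i j) U :=
  contDiffOn_inv hG.smooth (fun _ hy => hG.det_ne_zero hy) i j

theorem smooth_christoffel (hG : IsMetricOn G U) (i j k : ι) :
    ContDiffOn ℝ ∞ (christoffel b G i j k) U := by
  unfold christoffel
  refine contDiffOn_const.mul (ContDiffOn.sum fun l _ => (hG.smooth_inv k l).mul ?_)
  exact ((contDiffOn_pd hG.isOpen (hG.smooth _ _)).add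
    (contDiffOn_pd hG.isOpen (hG.smooth _ _))).sub (contDiffOn_pd hG.isOpen (hG.smooth _ _))

theorem smooth_grad (hG : IsMetricOn G U) (hf : ContDiffOn ℝ ∞ f U) (k : ι) :
    ContDiffOn ℝ ∞ (grad b G f k) U :=
  ContDiffOn.sum fun l _ => (hG.smooth_inv k l).mul (contDiffOn_pd hG.isOpen hf)

theorem smooth_gradSq (hG : IsMetricOn G U) (hf : ContDiffOn ℝ ∞ f U) :
    ContDiffOn ℝ ∞ (gradSq b G f) U :=
  ContDiffOn.sum fun k _ => (hG.smooth_grad hf k).mul (contDiffOn_pd hG.isOpen hf)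

theorem smooth_hessEndo (hG : IsMetricOn G U) (hf : ContDiffOn ℝ ∞ f U) (a c : ι) :
    ContDiffOn ℝ ∞ (hessEndo b G f a c) U :=
  (contDiffOn_pd hG.isOpen (hG.smooth_grad hf c)).add
    (ContDiffOn.sum fun d _ => (hG.smooth_christoffel a d c).mul (hG.smooth_grad hf d))

theorem christoffel_symm (hG : IsMetricOn G U) (hy : y ∈ U) (i j k : ι) :
    christoffel b G i j k y = christoffel b G j i k y := by
  unfold christoffel
  congr 1
  refine Finset.sum_congr rfl fun l _ => ?_
  rw [hG.pd_symm hy l i j]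
  ring

theorem sum_mul_grad (hG : IsMetricOn G U) (hy : y ∈ U) (e : ι) :
    ∑ c, G y e c * grad b G f c y = pd b e f y := by
  have : (G y).mulVec ((G y)⁻¹.mulVec fun l => pd b l f y) = fun l => pd b l f y := by
    rw [Matrix.mulVec_mulVec, hG.mul_inv hy, Matrix.one_mulVec]
  exact congrFun this e

theorem sum_mul_christoffel (hG : IsMetricOn G U) (hy : y ∈ U) (i j e : ι) :
    ∑ k, G y e k * christoffel b G i j k y = (1 / 2 : ℝ) *
      (pd b i (fun z => G z j e) y + pd b j (fun z => G z i e) y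
        - pd b e (fun z => G z i j) y) := by
  have : (G y).mulVec ((1 / 2 : ℝ) • (G y)⁻¹.mulVec fun l =>
      (pd b i (fun z => G z j l) y + pd b j (fun z => G z i l) y - pd b l (fun z => G z i j) y))
      = (1 / 2 : ℝ) • fun l => (pd b i (fun z => G z j l) y + pd b j (fun z => G z i l) y
        - pd b l (fun z => G z i j) y) := by
    rw [Matrix.mulVec_smul, Matrix.mulVec_mulVec, hG.mul_inv hy, Matrix.one_mulVec]
  exact congrFun this e

/-- This is `∇g = 0`: when the two lowered Christoffel symbols are added, four of the six derivative
terms cancel. -/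
theorem pd_metric (hG : IsMetricOn G U) (hy : y ∈ U) (a e c : ι) :
    pd b a (fun z => G z e c) y
      = ∑ k, G y e k * christoffel b G a c k y + ∑ k, G y c k * christoffel b G a e k y := by
  rw [hG.sum_mul_christoffel hy, hG.sum_mul_christoffel hy, hG.pd_symm hy a c e,
    hG.pd_symm hy e a c, hG.pd_symm hy c a e]
  ring

/-- Lowering an index commutes with covariant differentiation: differentiate `g_ec f^c = f_e` and
replace the derivative of the metric by Christoffel symbols through `pd_metric`. -/
theorem sum_mul_hessEndo (hG : IsMetricOn G U) (hf : ContDiffOn ℝ ∞ f U) (hy : y ∈ U) (a e : ι) :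
    ∑ c, G y e c * hessEndo b G f a c y = hess b G f a e y := by
  have hd : ∀ {h : E → ℝ}, ContDiffOn ℝ ∞ h U → DifferentiableAt ℝ h y :=
    fun hh => differentiableAt_of_contDiffOn hG.isOpen hh hy
  have h1 : pd b a (pd b e f) y = ∑ c, (pd b a (fun z => G z e c) y * grad b G f c y
      + G y e c * pd b a (grad b G f c) y) := by
    rw [← pd_congr hG.isOpen (fun z hz => hG.sum_mul_grad (b := b) (f := f) hz e) hy, pd_sum]
    · refine Finset.sum_congr rfl fun c _ => ?_
      rw [pd_mul (hd (hG.smooth e c)) (hd (hG.smooth_grad hf c))]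
    · exact fun c _ => (hd (hG.smooth e c)).mul (hd (hG.smooth_grad hf c))
  have h2 : ∑ d, christoffel b G a e d y * pd b d f y
      = ∑ c, (∑ k, G y c k * christoffel b G a e k y) * grad b G f c y := by
    simp_rw [← hG.sum_mul_grad (b := b) (f := f) hy, Finset.mul_sum, Finset.sum_mul]
    rw [Finset.sum_comm]
    refine Finset.sum_congr rfl fun c _ => Finset.sum_congr rfl fun k _ => ?_
    rw [hG.symm_apply hy k c]; ring
  have h3 : ∑ c, G y e c * ∑ d, christoffel b G a d c y * grad b G f d y
      = ∑ c, (∑ k, G y e k * christoffel b G a c k y) * grad b G f c y := by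
    simp_rw [Finset.mul_sum, Finset.sum_mul]
    rw [Finset.sum_comm]
    refine Finset.sum_congr rfl fun c _ => Finset.sum_congr rfl fun k _ => ?_
    ring
  unfold hess hessEndo
  rw [h1, h2]
  simp_rw [mul_add, Finset.sum_add_distrib]
  rw [h3]
  simp_rw [hG.pd_metric hy, add_mul, Finset.sum_add_distrib]
  ring

theorem hess_symm (hG : IsMetricOn G U) (hf : ContDiffOn ℝ ∞ f U) (hy : y ∈ U) (a c : ι) :
    hess b G f a c y = hess b G f c a y := by
  unfold hess
  rw [pd_pd_comm hG.isOpen hf hy]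
  simp_rw [hG.christoffel_symm hy a c]

theorem hessEndo_eq (hG : IsMetricOn G U) (hf : ContDiffOn ℝ ∞ f U) (hy : y ∈ U) (a c : ι) :
    hessEndo b G f a c y = ∑ e, (G y)⁻¹ c e * hess b G f a e y := by
  have : (G y)⁻¹.mulVec ((G y).mulVec fun c => hessEndo b G f a c y)
      = fun c => hessEndo b G f a c y := by
    rw [Matrix.mulVec_mulVec, hG.inv_mul hy, Matrix.one_mulVec]
  rw [← congrFun this c]
  exact Finset.sum_congr rfl fun e _ => congrArg _ (hG.sum_mul_hessEndo hf hy a e)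

theorem sum_hess_mul_grad (hG : IsMetricOn G U) (hf : ContDiffOn ℝ ∞ f U) (hy : y ∈ U) (a : ι) :
    ∑ c, hess b G f a c y * grad b G f c y = ∑ c, hessEndo b G f a c y * pd b c f y := by
  simp_rw [← hG.sum_mul_hessEndo hf hy, ← hG.sum_mul_grad (b := b) (f := f) hy, Finset.mul_sum,
    Finset.sum_mul]
  rw [Finset.sum_comm]
  refine Finset.sum_congr rfl fun c _ => Finset.sum_congr rfl fun k _ => ?_
  rw [hG.symm_apply hy k c]; ring

/-- The product rule hits `f^c` and `f_c`; the Christoffel corrections that turn the two derivatives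
into Hessians cancel, and the two resulting halves agree by `sum_hess_mul_grad`. -/
theorem pd_gradSq (hG : IsMetricOn G U) (hf : ContDiffOn ℝ ∞ f U) (hy : y ∈ U) (a : ι) :
    pd b a (gradSq b G f) y = 2 * ∑ c, hessEndo b G f a c y * pd b c f y := by
  have hd : ∀ {h : E → ℝ}, ContDiffOn ℝ ∞ h U → DifferentiableAt ℝ h y :=
    fun hh => differentiableAt_of_contDiffOn hG.isOpen hh hy
  have h1 : pd b a (gradSq b G f) y = ∑ c, (pd b a (grad b G f c) y * pd b c f y
      + grad b G f c y * pd b a (pd b c f) y) := by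
    unfold gradSq
    rw [pd_sum]
    · refine Finset.sum_congr rfl fun c _ => ?_
      rw [pd_mul (hd (hG.smooth_grad hf c)) (hd (contDiffOn_pd hG.isOpen hf))]
    · exact fun c _ => (hd (hG.smooth_grad hf c)).mul (hd (contDiffOn_pd hG.isOpen hf))
  have h2 : ∑ c, (∑ d, christoffel b G a d c y * grad b G f d y) * pd b c f y
      = ∑ c, (∑ d, christoffel b G a c d y * pd b d f y) * grad b G f c y := by
    simp_rw [Finset.sum_mul]
    rw [Finset.sum_comm]
    refine Finset.sum_congr rfl fun c _ => Finset.sum_congr rfl fun k _ => ?_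
    ring
  have h3 : ∑ c, hessEndo b G f a c y * pd b c f y + ∑ c, hess b G f a c y * grad b G f c y
      = pd b a (gradSq b G f) y := by
    unfold hess hessEndo
    simp_rw [add_mul, sub_mul, Finset.sum_add_distrib, Finset.sum_sub_distrib]
    rw [h1, h2, Finset.sum_add_distrib]
    simp_rw [mul_comm (grad b G f _ y) (pd b a _ y)]
    ring
  rw [hG.sum_hess_mul_grad hf hy] at h3
  linarith

end IsMetricOn

end RiemCoord

namespace RiemCoord

/-! ### Partial derivatives on a product of coordinate patches -/

section Product

variable {E E' : Type*} [NormedAddCommGroup E] [NormedSpace ℝ E]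
  [NormedAddCommGroup E'] [NormedSpace ℝ E'] {ι κ : Type*}
  {b : Module.Basis ι ℝ E} {b' : Module.Basis κ ℝ E'} {y : E × E'}

theorem pd_inl_comp_fst {h : E → ℝ} (hh : DifferentiableAt ℝ h y.1) (a : ι) :
    pd (b.prod b') (Sum.inl a) (fun z => h z.1) y = pd b a h y.1 := by
  have := (hh.hasFDerivAt.comp y hasFDerivAt_fst).fderiv
  unfold pd
  rw [show (fun z : E × E' => h z.1) = h ∘ Prod.fst from rfl, this]
  simp

theorem pd_inr_comp_fst {h : E → ℝ} (hh : DifferentiableAt ℝ h y.1) (i : κ) :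
    pd (b.prod b') (Sum.inr i) (fun z => h z.1) y = 0 := by
  have := (hh.hasFDerivAt.comp y hasFDerivAt_fst).fderiv
  unfold pd
  rw [show (fun z : E × E' => h z.1) = h ∘ Prod.fst from rfl, this]
  simp

theorem pd_inl_comp_snd {h : E' → ℝ} (hh : DifferentiableAt ℝ h y.2) (a : ι) :
    pd (b.prod b') (Sum.inl a) (fun z => h z.2) y = 0 := by
  have := (hh.hasFDerivAt.comp y hasFDerivAt_snd).fderiv
  unfold pd
  rw [show (fun z : E × E' => h z.2) = h ∘ Prod.snd from rfl, this]
  simp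

theorem pd_inr_comp_snd {h : E' → ℝ} (hh : DifferentiableAt ℝ h y.2) (i : κ) :
    pd (b.prod b') (Sum.inr i) (fun z => h z.2) y = pd b' i h y.2 := by
  have := (hh.hasFDerivAt.comp y hasFDerivAt_snd).fderiv
  unfold pd
  rw [show (fun z : E × E' => h z.2) = h ∘ Prod.snd from rfl, this]
  simp

theorem pd_inl_fst_mul_snd {h : E → ℝ} {k : E' → ℝ} (hh : DifferentiableAt ℝ h y.1)
    (hk : DifferentiableAt ℝ k y.2) (a : ι) :
    pd (b.prod b') (Sum.inl a) (fun z => h z.1 * k z.2) y = pd b a h y.1 * k y.2 := by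
  rw [pd_mul (f := fun z : E × E' => h z.1) (g := fun z : E × E' => k z.2)
    (hh.comp y differentiableAt_fst) (hk.comp y differentiableAt_snd), pd_inl_comp_fst hh,
    pd_inl_comp_snd hk]
  ring

theorem pd_inr_fst_mul_snd {h : E → ℝ} {k : E' → ℝ} (hh : DifferentiableAt ℝ h y.1)
    (hk : DifferentiableAt ℝ k y.2) (i : κ) :
    pd (b.prod b') (Sum.inr i) (fun z => h z.1 * k z.2) y = h y.1 * pd b' i k y.2 := by
  rw [pd_mul (f := fun z : E × E' => h z.1) (g := fun z : E × E' => k z.2)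
    (hh.comp y differentiableAt_fst) (hk.comp y differentiableAt_snd), pd_inr_comp_fst hh,
    pd_inr_comp_snd hk]
  ring

end Product

/-- `W` is the component matrix, on `U × V`, of the warped product of the metrics `G` and `N`
with warping function `f`. -/
structure IsWarpedOn {E E' : Type*} [NormedAddCommGroup E] [NormedSpace ℝ E]
    [NormedAddCommGroup E'] [NormedSpace ℝ E'] {ι κ : Type*} [Fintype ι] [Fintype κ]
    (G : E → Matrix ι ι ℝ) (N : E' → Matrix κ κ ℝ) (f : E → ℝ) (U : Set E) (V : Set E')
    (W : E × E' → Matrix (ι ⊕ κ) (ι ⊕ κ) ℝ) : Prop where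
  base : IsMetricOn G U
  fibre : IsMetricOn N V
  smooth : ContDiffOn ℝ ∞ f U
  pos : ∀ u ∈ U, 0 < f u
  eq : ∀ y ∈ U ×ˢ V, W y = Matrix.fromBlocks (G y.1) 0 0 (f y.1 ^ 2 • N y.2)

namespace IsWarpedOn

variable {E E' : Type*} [NormedAddCommGroup E] [NormedSpace ℝ E]
  [NormedAddCommGroup E'] [NormedSpace ℝ E'] {ι κ : Type*} [Fintype ι] [Fintype κ]
  [DecidableEq ι] [DecidableEq κ]
  {b : Module.Basis ι ℝ E} {b' : Module.Basis κ ℝ E'}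
  {G : E → Matrix ι ι ℝ} {N : E' → Matrix κ κ ℝ} {f : E → ℝ} {U : Set E} {V : Set E'}
  {W : E × E' → Matrix (ι ⊕ κ) (ι ⊕ κ) ℝ} {y : E × E'}

/-! ### Christoffel symbols of a warped product; in lemma names `l` marks a base index and `r` a
fibre index -/

section Christoffel

omit [DecidableEq ι] [DecidableEq κ]

theorem isOpen (h : IsWarpedOn G N f U V W) : IsOpen (U ×ˢ V) :=
  h.base.isOpen.prod h.fibre.isOpen

theorem diff_base (h : IsWarpedOn G N f U V W) (hy : y ∈ U ×ˢ V) {F : E → ℝ}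
    (hF : ContDiffOn ℝ ∞ F U) : DifferentiableAt ℝ F y.1 :=
  differentiableAt_of_contDiffOn h.base.isOpen hF hy.1

theorem diff_fibre (h : IsWarpedOn G N f U V W) (hy : y ∈ U ×ˢ V) {F : E' → ℝ}
    (hF : ContDiffOn ℝ ∞ F V) : DifferentiableAt ℝ F y.2 :=
  differentiableAt_of_contDiffOn h.fibre.isOpen hF hy.2

theorem pd_W_inl_inr (h : IsWarpedOn G N f U V W) (hy : y ∈ U ×ˢ V) (I : ι ⊕ κ) (a : ι) (j : κ) :
    pd (b.prod b') I (fun z => W z (Sum.inl a) (Sum.inr j)) y = 0 := by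
  rw [pd_congr h.isOpen (g := fun _ => 0) (fun z hz => by simp [h.eq z hz]) hy, pd_const]

theorem pd_W_inr_inl (h : IsWarpedOn G N f U V W) (hy : y ∈ U ×ˢ V) (I : ι ⊕ κ) (a : ι) (j : κ) :
    pd (b.prod b') I (fun z => W z (Sum.inr j) (Sum.inl a)) y = 0 := by
  rw [pd_congr h.isOpen (g := fun _ => 0) (fun z hz => by simp [h.eq z hz]) hy, pd_const]

theorem pd_inl_W_inl_inl (h : IsWarpedOn G N f U V W) (hy : y ∈ U ×ˢ V) (a c d : ι) :
    pd (b.prod b') (Sum.inl a) (fun z => W z (Sum.inl c) (Sum.inl d)) y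
      = pd b a (fun u => G u c d) y.1 := by
  rw [pd_congr h.isOpen (g := fun z => G z.1 c d) (fun z hz => by simp [h.eq z hz]) hy,
    pd_inl_comp_fst (h := fun u => G u c d) (h.diff_base hy (h.base.smooth c d))]

theorem pd_inr_W_inl_inl (h : IsWarpedOn G N f U V W) (hy : y ∈ U ×ˢ V) (i : κ) (c d : ι) :
    pd (b.prod b') (Sum.inr i) (fun z => W z (Sum.inl c) (Sum.inl d)) y = 0 := by
  rw [pd_congr h.isOpen (g := fun z => G z.1 c d) (fun z hz => by simp [h.eq z hz]) hy,
    pd_inr_comp_fst (h := fun u => G u c d) (h.diff_base hy (h.base.smooth c d))]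

theorem pd_inl_W_inr_inr (h : IsWarpedOn G N f U V W) (hy : y ∈ U ×ˢ V) (a : ι) (i j : κ) :
    pd (b.prod b') (Sum.inl a) (fun z => W z (Sum.inr i) (Sum.inr j)) y
      = 2 * f y.1 * pd b a f y.1 * N y.2 i j := by
  rw [pd_congr h.isOpen (g := fun z => (f z.1 * f z.1) * N z.2 i j)
    (fun z hz => by simp [h.eq z hz, sq]) hy,
    pd_inl_fst_mul_snd (h := fun u => f u * f u) (k := fun w => N w i j)
      (h.diff_base hy (h.smooth.mul h.smooth)) (h.diff_fibre hy (h.fibre.smooth i j)),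
    pd_mul (h.diff_base hy h.smooth) (h.diff_base hy h.smooth)]
  ring

theorem pd_inr_W_inr_inr (h : IsWarpedOn G N f U V W) (hy : y ∈ U ×ˢ V) (k i j : κ) :
    pd (b.prod b') (Sum.inr k) (fun z => W z (Sum.inr i) (Sum.inr j)) y
      = f y.1 ^ 2 * pd b' k (fun w => N w i j) y.2 := by
  rw [pd_congr h.isOpen (g := fun z => (f z.1 * f z.1) * N z.2 i j)
    (fun z hz => by simp [h.eq z hz, sq]) hy,
    pd_inr_fst_mul_snd (h := fun u => f u * f u) (k := fun w => N w i j)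
      (h.diff_base hy (h.smooth.mul h.smooth)) (h.diff_fibre hy (h.fibre.smooth i j))]
  ring

end Christoffel

theorem inv_eq (h : IsWarpedOn G N f U V W) (hy : y ∈ U ×ˢ V) :
    (W y)⁻¹ = Matrix.fromBlocks (G y.1)⁻¹ 0 0 ((f y.1 ^ 2)⁻¹ • (N y.2)⁻¹) := by
  have hf : f y.1 ^ 2 ≠ 0 := pow_ne_zero 2 (h.pos _ hy.1).ne'
  apply Matrix.inv_eq_left_inv
  rw [h.eq y hy, Matrix.fromBlocks_multiply]
  simp [h.base.inv_mul hy.1, h.fibre.inv_mul hy.2, smul_smul, hf]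

theorem christoffel_lll (h : IsWarpedOn G N f U V W) (hy : y ∈ U ×ˢ V) (a c d : ι) :
    christoffel (b.prod b') W (Sum.inl a) (Sum.inl c) (Sum.inl d) y
      = christoffel b G a c d y.1 := by
  simp [christoffel, h.inv_eq hy, h.pd_inl_W_inl_inl hy]

theorem christoffel_llr (h : IsWarpedOn G N f U V W) (hy : y ∈ U ×ˢ V) (a c : ι) (k : κ) :
    christoffel (b.prod b') W (Sum.inl a) (Sum.inl c) (Sum.inr k) y = 0 := by
  simp [christoffel, h.inv_eq hy, h.pd_W_inl_inr hy, h.pd_inr_W_inl_inl hy]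

theorem christoffel_lrl (h : IsWarpedOn G N f U V W) (hy : y ∈ U ×ˢ V) (a c : ι) (j : κ) :
    christoffel (b.prod b') W (Sum.inl a) (Sum.inr j) (Sum.inl c) y = 0 := by
  simp [christoffel, h.inv_eq hy, h.pd_W_inl_inr hy, h.pd_W_inr_inl hy, h.pd_inr_W_inl_inl hy]

theorem christoffel_rll (h : IsWarpedOn G N f U V W) (hy : y ∈ U ×ˢ V) (a c : ι) (j : κ) :
    christoffel (b.prod b') W (Sum.inr j) (Sum.inl a) (Sum.inl c) y = 0 := by
  simp [christoffel, h.inv_eq hy, h.pd_W_inl_inr hy, h.pd_W_inr_inl hy, h.pd_inr_W_inl_inl hy]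

omit [DecidableEq ι] in
theorem sum_inv_mul_fibre (h : IsWarpedOn G N f U V W) (hy : y ∈ U ×ˢ V) (j k : κ) :
    ∑ l, (N y.2)⁻¹ k l * N y.2 j l = if j = k then 1 else 0 := by
  have := congrFun (congrFun (h.fibre.inv_mul hy.2) k) j
  rw [Matrix.mul_apply, Matrix.one_apply] at this
  simp_rw [h.fibre.symm_apply hy.2 j]
  rw [this]
  simp [eq_comm]

theorem christoffel_lrr (h : IsWarpedOn G N f U V W) (hy : y ∈ U ×ˢ V) (a : ι) (j k : κ) :
    christoffel (b.prod b') W (Sum.inl a) (Sum.inr j) (Sum.inr k) y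
      = (pd b a f y.1 / f y.1) * (if j = k then 1 else 0) := by
  have hf : f y.1 ≠ 0 := (h.pos _ hy.1).ne'
  rw [← h.sum_inv_mul_fibre hy]
  simp only [christoffel, h.inv_eq hy, Fintype.sum_sum_type, Matrix.fromBlocks_apply₂₁,
    Matrix.zero_apply, zero_mul, Finset.sum_const_zero, Matrix.fromBlocks_apply₂₂,
    h.pd_W_inl_inr hy, h.pd_inl_W_inr_inr hy, Matrix.smul_apply, smul_eq_mul, Finset.mul_sum,
    zero_add]
  refine Finset.sum_congr rfl fun l _ => ?_
  field_simp
  ring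

theorem christoffel_rlr (h : IsWarpedOn G N f U V W) (hy : y ∈ U ×ˢ V) (a : ι) (j k : κ) :
    christoffel (b.prod b') W (Sum.inr j) (Sum.inl a) (Sum.inr k) y
      = (pd b a f y.1 / f y.1) * (if j = k then 1 else 0) := by
  rw [← h.christoffel_lrr (b' := b') hy]
  simp only [christoffel, h.inv_eq hy, Fintype.sum_sum_type, Matrix.fromBlocks_apply₂₁,
    Matrix.zero_apply, zero_mul, Finset.sum_const_zero, Matrix.fromBlocks_apply₂₂,
    h.pd_W_inl_inr hy, h.pd_W_inr_inl hy, zero_add, add_zero]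

theorem christoffel_rrl (h : IsWarpedOn G N f U V W) (hy : y ∈ U ×ˢ V) (i j : κ) (c : ι) :
    christoffel (b.prod b') W (Sum.inr i) (Sum.inr j) (Sum.inl c) y
      = - (f y.1 * grad b G f c y.1 * N y.2 i j) := by
  simp only [christoffel, grad, h.inv_eq hy, Fintype.sum_sum_type, Matrix.fromBlocks_apply₁₁,
    Matrix.zero_apply, zero_mul, Finset.sum_const_zero, Matrix.fromBlocks_apply₁₂,
    h.pd_W_inr_inl hy, h.pd_inl_W_inr_inr hy, Finset.mul_sum, Finset.sum_mul, add_zero,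
    ← Finset.sum_neg_distrib]
  refine Finset.sum_congr rfl fun l _ => ?_
  ring

theorem christoffel_rrr (h : IsWarpedOn G N f U V W) (hy : y ∈ U ×ˢ V) (i j k : κ) :
    christoffel (b.prod b') W (Sum.inr i) (Sum.inr j) (Sum.inr k) y
      = christoffel b' N i j k y.2 := by
  have hf : f y.1 ≠ 0 := (h.pos _ hy.1).ne'
  simp only [christoffel, h.inv_eq hy, Fintype.sum_sum_type, Matrix.fromBlocks_apply₂₁,
    Matrix.zero_apply, zero_mul, Finset.sum_const_zero, Matrix.fromBlocks_apply₂₂,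
    h.pd_inr_W_inr_inr hy, zero_add, Matrix.smul_apply, smul_eq_mul]
  congr 1
  refine Finset.sum_congr rfl fun l _ => ?_
  field_simp

/-! The components of the curvature tensor of the warped product. -/

section Curvature

/-- The derivative of the factor `f` in `Γ_ij^c = -f f^c N_ij` cancels against the product with
`Γ_aj^k = (f_a / f) δ_jk`. What survives is the covariant derivative of the gradient. -/
theorem curvature_lrrl (h : IsWarpedOn G N f U V W) (hy : y ∈ U ×ˢ V) (a c : ι) (i j : κ) :
    curvature (b.prod b') W (Sum.inl a) (Sum.inr i) (Sum.inr j) (Sum.inl c) y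
      = f y.1 * hessEndo b G f a c y.1 * N y.2 i j := by
  have hf : f y.1 ≠ 0 := (h.pos _ hy.1).ne'
  have h1 : pd (b.prod b') (Sum.inr i)
      (christoffel (b.prod b') W (Sum.inl a) (Sum.inr j) (Sum.inl c)) y = 0 := by
    rw [pd_congr h.isOpen (g := fun _ => 0) (fun z hz => h.christoffel_lrl hz a c j) hy, pd_const]
  have h2 : pd (b.prod b') (Sum.inl a)
      (christoffel (b.prod b') W (Sum.inr i) (Sum.inr j) (Sum.inl c)) y
      = - (pd b a f y.1 * grad b G f c y.1 + f y.1 * pd b a (grad b G f c) y.1) * N y.2 i j := by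
    rw [pd_congr h.isOpen (g := fun z => - (f z.1 * grad b G f c z.1 * N z.2 i j))
      (fun z hz => h.christoffel_rrl hz i j c) hy, pd_neg,
      pd_inl_fst_mul_snd (h := fun u => f u * grad b G f c u) (k := fun w => N w i j)
        (h.diff_base hy (h.smooth.mul (h.base.smooth_grad h.smooth c)))
        (h.diff_fibre hy (h.fibre.smooth i j)),
      pd_mul (h.diff_base hy h.smooth) (h.diff_base hy (h.base.smooth_grad h.smooth c))]
    ring
  unfold curvature
  rw [h1, h2]
  simp only [Fintype.sum_sum_type, h.christoffel_rll hy, h.christoffel_lrl hy,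
    h.christoffel_lll hy, h.christoffel_rrl hy, h.christoffel_lrr hy, hessEndo, mul_zero, zero_mul,
    zero_sub, sub_zero, mul_ite, mul_one, Finset.sum_ite_eq, Finset.mem_univ, if_true,
    mul_neg, neg_neg, mul_add, add_mul, Finset.mul_sum, Finset.sum_mul, neg_mul, neg_add]
  have : ∀ x : ι, christoffel b G a x c y.1 * (f y.1 * grad b G f x y.1 * N y.2 i j)
      = f y.1 * (christoffel b G a x c y.1 * grad b G f x y.1) * N y.2 i j := fun x => by ring
  simp only [this]
  field_simp
  ring

theorem curvature_lrrr (h : IsWarpedOn G N f U V W) (hy : y ∈ U ×ˢ V) (a : ι) (i j k : κ) :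
    curvature (b.prod b') W (Sum.inl a) (Sum.inr i) (Sum.inr j) (Sum.inr k) y = 0 := by
  have hd : DifferentiableAt ℝ (fun u => pd b a f u / f u * if j = k then (1 : ℝ) else 0) y.1 :=
    h.diff_base hy (((contDiffOn_pd h.base.isOpen h.smooth).div h.smooth
      fun u hu => (h.pos u hu).ne').mul contDiffOn_const)
  have h1 : pd (b.prod b') (Sum.inr i)
      (christoffel (b.prod b') W (Sum.inl a) (Sum.inr j) (Sum.inr k)) y = 0 := by
    rw [pd_congr h.isOpen (fun z hz => h.christoffel_lrr hz a j k) hy,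
      pd_inr_comp_fst (h := fun u => pd b a f u / f u * if j = k then (1 : ℝ) else 0) hd]
  have h2 : pd (b.prod b') (Sum.inl a)
      (christoffel (b.prod b') W (Sum.inr i) (Sum.inr j) (Sum.inr k)) y = 0 := by
    rw [pd_congr h.isOpen (fun z hz => h.christoffel_rrr hz i j k) hy,
      pd_inl_comp_snd (h := christoffel b' N i j k)
        (h.diff_fibre hy (h.fibre.smooth_christoffel i j k))]
  unfold curvature
  rw [h1, h2]
  simp [Fintype.sum_sum_type, h.christoffel_lrl hy, h.christoffel_llr hy,
    h.christoffel_rrr hy, h.christoffel_lrr hy, Finset.sum_sub_distrib, mul_comm]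

/-- The derivative terms are the antisymmetrized second derivatives of `log f`, and the quadratic
terms commute. -/
theorem curvature_llrr (h : IsWarpedOn G N f U V W) (hy : y ∈ U ×ˢ V) (a c : ι) (j k : κ) :
    curvature (b.prod b') W (Sum.inl a) (Sum.inl c) (Sum.inr j) (Sum.inr k) y = 0 := by
  have h0 : ∀ a, ContDiffOn ℝ ∞ (pd b a f) U := fun a => contDiffOn_pd h.base.isOpen h.smooth
  have h1 : ∀ a c, pd (b.prod b') (Sum.inl a)
      (christoffel (b.prod b') W (Sum.inl c) (Sum.inr j) (Sum.inr k)) y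
      = (pd b a (pd b c f) y.1 * f y.1 - pd b c f y.1 * pd b a f y.1) / f y.1 ^ 2
        * if j = k then (1 : ℝ) else 0 := by
    intro a c
    have hd : ContDiffOn ℝ ∞ (fun u => pd b c f u / f u) U :=
      (h0 c).div h.smooth fun u hu => (h.pos u hu).ne'
    rw [pd_congr h.isOpen (fun z hz => h.christoffel_lrr hz c j k) hy,
      pd_inl_comp_fst (h := fun u => pd b c f u / f u * if j = k then (1 : ℝ) else 0)
        (h.diff_base hy (hd.mul contDiffOn_const)),
      pd_mul (h.diff_base hy hd) (by fun_prop),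
      pd_div (h.diff_base hy (h0 c)) (h.diff_base hy h.smooth) (h.pos _ hy.1).ne', pd_const]
    ring
  unfold curvature
  rw [h1, h1, pd_pd_comm h.base.isOpen h.smooth hy.1 a]
  simp only [Fintype.sum_sum_type, h.christoffel_lrl hy, h.christoffel_llr hy,
    h.christoffel_lrr hy, Finset.sum_sub_distrib, mul_zero, zero_mul,
    Finset.sum_const_zero, zero_add, mul_ite, mul_one, ite_mul, Finset.sum_ite_eq,
    Finset.mem_univ, if_true]
  split_ifs <;> ring

theorem curvature_llrl (h : IsWarpedOn G N f U V W) (hy : y ∈ U ×ˢ V) (a c d : ι) (j : κ) :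
    curvature (b.prod b') W (Sum.inl a) (Sum.inl c) (Sum.inr j) (Sum.inl d) y = 0 := by
  have h1 : ∀ a c, pd (b.prod b') (Sum.inl a)
      (christoffel (b.prod b') W (Sum.inl c) (Sum.inr j) (Sum.inl d)) y = 0 := by
    intro a c
    rw [pd_congr h.isOpen (g := fun _ => 0) (fun z hz => h.christoffel_lrl hz c d j) hy, pd_const]
  simp [curvature, h1, Fintype.sum_sum_type, h.christoffel_lrl hy]

theorem curvature_lrlr (h : IsWarpedOn G N f U V W) (hy : y ∈ U ×ˢ V) (a c : ι) (i k : κ) :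
    curvature (b.prod b') W (Sum.inl a) (Sum.inr i) (Sum.inl c) (Sum.inr k) y
      = - (hess b G f a c y.1 / f y.1) * if i = k then (1 : ℝ) else 0 := by
  have hf : f y.1 ≠ 0 := (h.pos _ hy.1).ne'
  have h0 : ∀ a, ContDiffOn ℝ ∞ (pd b a f) U := fun a => contDiffOn_pd h.base.isOpen h.smooth
  have h1 : pd (b.prod b') (Sum.inr i)
      (christoffel (b.prod b') W (Sum.inl a) (Sum.inl c) (Sum.inr k)) y = 0 := by
    rw [pd_congr h.isOpen (g := fun _ => 0) (fun z hz => h.christoffel_llr hz a c k) hy, pd_const]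
  have h2 : pd (b.prod b') (Sum.inl a)
      (christoffel (b.prod b') W (Sum.inr i) (Sum.inl c) (Sum.inr k)) y
      = (pd b a (pd b c f) y.1 * f y.1 - pd b c f y.1 * pd b a f y.1) / f y.1 ^ 2
        * if i = k then (1 : ℝ) else 0 := by
    have hd : ContDiffOn ℝ ∞ (fun u => pd b c f u / f u) U :=
      (h0 c).div h.smooth fun u hu => (h.pos u hu).ne'
    rw [pd_congr h.isOpen (fun z hz => h.christoffel_rlr hz c i k) hy,
      pd_inl_comp_fst (h := fun u => pd b c f u / f u * if i = k then (1 : ℝ) else 0)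
        (h.diff_base hy (hd.mul contDiffOn_const)),
      pd_mul (h.diff_base hy hd) (by fun_prop),
      pd_div (h.diff_base hy (h0 c)) (h.diff_base hy h.smooth) hf, pd_const]
    ring
  unfold curvature
  rw [h1, h2]
  simp only [Fintype.sum_sum_type, h.christoffel_rll hy, h.christoffel_llr hy,
    h.christoffel_lll hy, h.christoffel_rlr hy, h.christoffel_lrr hy, mul_zero, zero_mul,
    zero_sub, sub_zero, mul_ite, mul_one, ite_mul, Finset.sum_neg_distrib, Finset.sum_ite_eq,
    Finset.mem_univ, if_true, hess]
  split_ifs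
  · have : ∑ x, pd b x f y.1 / f y.1 * christoffel b G a c x y.1
        = (∑ d, christoffel b G a c d y.1 * pd b d f y.1) / f y.1 := by
      rw [Finset.sum_div]
      exact Finset.sum_congr rfl fun _ _ => by ring
    rw [this]
    field_simp
    ring
  · simp

/-- A Gauss equation: summation over intermediate base indices pairs `f_c / f` with `-f f^c N`,
which produces the multiple of `|∇f|²`. -/
theorem curvature_rrrr (h : IsWarpedOn G N f U V W) (hy : y ∈ U ×ˢ V) (i j l k : κ) :
    curvature (b.prod b') W (Sum.inr i) (Sum.inr j) (Sum.inr l) (Sum.inr k) y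
      = curvature b' N i j l k y.2 - gradSq b G f y.1 *
        ((if j = k then 1 else 0) * N y.2 i l - (if i = k then 1 else 0) * N y.2 j l) := by
  have hf : f y.1 ≠ 0 := (h.pos _ hy.1).ne'
  have h1 : ∀ i j, pd (b.prod b') (Sum.inr j)
      (christoffel (b.prod b') W (Sum.inr i) (Sum.inr l) (Sum.inr k)) y
      = pd b' j (christoffel b' N i l k) y.2 := by
    intro i j
    rw [pd_congr h.isOpen (fun z hz => h.christoffel_rrr hz i l k) hy,
      pd_inr_comp_snd (h := christoffel b' N i l k)
        (h.diff_fibre hy (h.fibre.smooth_christoffel i l k))]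
  unfold curvature
  rw [h1, h1]
  simp only [Fintype.sum_sum_type, h.christoffel_rlr hy, h.christoffel_rrl hy,
    h.christoffel_rrr hy]
  have h2 : ∑ c, (pd b c f y.1 / f y.1 * (if j = k then 1 else 0)
        * -(f y.1 * grad b G f c y.1 * N y.2 i l)
      - pd b c f y.1 / f y.1 * (if i = k then 1 else 0) * -(f y.1 * grad b G f c y.1 * N y.2 j l))
      = - (gradSq b G f y.1 *
        ((if j = k then 1 else 0) * N y.2 i l - (if i = k then 1 else 0) * N y.2 j l)) := by
    rw [gradSq, Finset.sum_mul, ← Finset.sum_neg_distrib]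
    refine Finset.sum_congr rfl fun c _ => ?_
    field_simp
    ring
  rw [h2]
  ring

end Curvature

end IsWarpedOn

end RiemCoord

/-! ### Ricci tensor and divergence of the curvature of a warped product -/

namespace RiemCoord

theorem curvature_antisymm {E : Type*} [NormedAddCommGroup E] [NormedSpace ℝ E] {ι : Type*}
    [Fintype ι] [DecidableEq ι] (b : Module.Basis ι ℝ E) (G : E → Matrix ι ι ℝ) (i j l k : ι)
    (y : E) : curvature b G i j l k y = - curvature b G j i l k y := by
  simp only [curvature, Finset.sum_sub_distrib]
  ring

/-- With one index, antisymmetry kills the curvature. This rules out a one-dimensional fibre once `κ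
> 0` is known. -/
theorem ricci_eq_zero_of_subsingleton {E : Type*} [NormedAddCommGroup E] [NormedSpace ℝ E]
    {ι : Type*} [Fintype ι] [DecidableEq ι] [Subsingleton ι] (b : Module.Basis ι ℝ E)
    (G : E → Matrix ι ι ℝ) (j k : ι) (y : E) : ricci b G j k y = 0 := by
  refine Finset.sum_eq_zero fun q _ => ?_
  have := curvature_antisymm b G j q k q y
  rw [Subsingleton.elim j q] at this ⊢
  linarith

namespace IsWarpedOn

variable {E E' : Type*} [NormedAddCommGroup E] [NormedSpace ℝ E]
  [NormedAddCommGroup E'] [NormedSpace ℝ E'] {ι κ : Type*} [Fintype ι] [Fintype κ]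
  [DecidableEq ι] [DecidableEq κ]
  {b : Module.Basis ι ℝ E} {b' : Module.Basis κ ℝ E'}
  {G : E → Matrix ι ι ℝ} {N : E' → Matrix κ κ ℝ} {f : E → ℝ} {U : Set E} {V : Set E'}
  {W : E × E' → Matrix (ι ⊕ κ) (ι ⊕ κ) ℝ} {y : E × E'}

theorem ricci_lr (h : IsWarpedOn G N f U V W) (hy : y ∈ U ×ˢ V) (a : ι) (j : κ) :
    ricci (b.prod b') W (Sum.inl a) (Sum.inr j) y = 0 := by
  simp [ricci, Fintype.sum_sum_type, h.curvature_llrl hy, h.curvature_lrrr hy]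

theorem sum_curvature_rrrr (h : IsWarpedOn G N f U V W) (hy : y ∈ U ×ˢ V) (i j : κ) :
    ∑ k, curvature (b.prod b') W (Sum.inr i) (Sum.inr k) (Sum.inr j) (Sum.inr k) y
      = ricci b' N i j y.2 - (Fintype.card κ - 1) * gradSq b G f y.1 * N y.2 i j := by
  simp only [ricci, h.curvature_rrrr hy, if_true, one_mul, ite_mul, zero_mul,
    Finset.sum_sub_distrib, ← Finset.mul_sum, Finset.sum_ite_eq, Finset.mem_univ,
    Finset.sum_const, Finset.card_univ, nsmul_eq_mul]
  ring

theorem ricci_rr (h : IsWarpedOn G N f U V W) (hy : y ∈ U ×ˢ V) (i j : κ) :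
    ricci (b.prod b') W (Sum.inr i) (Sum.inr j) y
      = ricci b' N i j y.2 - (f y.1 * ∑ c, hessEndo b G f c c y.1
        + (Fintype.card κ - 1) * gradSq b G f y.1) * N y.2 i j := by
  have h1 : ∑ c, curvature (b.prod b') W (Sum.inr i) (Sum.inl c) (Sum.inr j) (Sum.inl c) y
      = - (f y.1 * (∑ c, hessEndo b G f c c y.1) * N y.2 i j) := by
    simp only [curvature_antisymm (b.prod b') W (Sum.inr i) (Sum.inl _), h.curvature_lrrl hy,
      Finset.mul_sum, Finset.sum_mul, Finset.sum_neg_distrib]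
  rw [ricci, Fintype.sum_sum_type, h1, h.sum_curvature_rrrr hy]
  ring

/-- The coefficient `p - 2` of `H∇f` has three sources. Differentiation along the base gives `-1`,
as the `f_c` from the factor `f` is overcompensated by two Christoffel terms (`hl`). Each of the `p`
fibre directions gives `+1`, and the single direction `k = i` gives a further `-1` (`hr`). The trace
over the fibre produces `Ric^N` and the `|∇f|²` term. -/
theorem divCurvature_lrr (h : IsWarpedOn G N f U V W) (hy : y ∈ U ×ˢ V) (a : ι) (i j : κ) :
    divCurvature (b.prod b') W (Sum.inl a) (Sum.inr i) (Sum.inr j) y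
      = (f y.1 * divHess b G f a y.1
          + (Fintype.card κ - 2) * ∑ c, hessEndo b G f a c y.1 * pd b c f y.1
          - (Fintype.card κ - 1) * gradSq b G f y.1 * (pd b a f y.1 / f y.1)) * N y.2 i j
        + pd b a f y.1 / f y.1 * ricci b' N i j y.2 := by
  have hf : f y.1 ≠ 0 := (h.pos _ hy.1).ne'
  have h1 : ∀ c, pd (b.prod b') (Sum.inl c)
      (curvature (b.prod b') W (Sum.inl a) (Sum.inr i) (Sum.inr j) (Sum.inl c)) y
      = (pd b c f y.1 * hessEndo b G f a c y.1 + f y.1 * pd b c (hessEndo b G f a c) y.1)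
        * N y.2 i j := by
    intro c
    rw [pd_congr h.isOpen (fun z hz => h.curvature_lrrl hz a c i j) hy,
      pd_inl_fst_mul_snd (h := fun u => f u * hessEndo b G f a c u) (k := fun w => N w i j)
        (h.diff_base hy (h.smooth.mul (h.base.smooth_hessEndo h.smooth a c)))
        (h.diff_fibre hy (h.fibre.smooth i j)),
      pd_mul (h.diff_base hy h.smooth) (h.diff_base hy (h.base.smooth_hessEndo h.smooth a c))]
  have h2 : ∀ k, pd (b.prod b') (Sum.inr k)
      (curvature (b.prod b') W (Sum.inl a) (Sum.inr i) (Sum.inr j) (Sum.inr k)) y = 0 := by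
    intro k
    rw [pd_congr h.isOpen (g := fun _ => 0) (fun z hz => h.curvature_lrrr hz a i j k) hy, pd_const]
  have h3 : ∑ k, curvature (b.prod b') W (Sum.inr k) (Sum.inr i) (Sum.inr j) (Sum.inr k) y
      = - (ricci b' N i j y.2 - (Fintype.card κ - 1) * gradSq b G f y.1 * N y.2 i j) := by
    rw [← h.sum_curvature_rrrr hy, ← Finset.sum_neg_distrib]
    exact Finset.sum_congr rfl fun k _ => curvature_antisymm _ _ _ _ _ _ _
  have h4 : ∑ c, (grad b G f c y.1 * hess b G f a c y.1)
      = ∑ c, hessEndo b G f a c y.1 * pd b c f y.1 := by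
    rw [← h.base.sum_hess_mul_grad h.smooth hy.1]
    exact Finset.sum_congr rfl fun c _ => mul_comm _ _
  have hl : ∀ c : ι,
      (pd (b.prod b') (Sum.inl c)
        (curvature (b.prod b') W (Sum.inl a) (Sum.inr i) (Sum.inr j) (Sum.inl c)) y
      + ∑ q, (christoffel (b.prod b') W (Sum.inl c) q (Sum.inl c) y
            * curvature (b.prod b') W (Sum.inl a) (Sum.inr i) (Sum.inr j) q y
        - christoffel (b.prod b') W (Sum.inl c) (Sum.inl a) q y
            * curvature (b.prod b') W q (Sum.inr i) (Sum.inr j) (Sum.inl c) y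
        - christoffel (b.prod b') W (Sum.inl c) (Sum.inr i) q y
            * curvature (b.prod b') W (Sum.inl a) q (Sum.inr j) (Sum.inl c) y
        - christoffel (b.prod b') W (Sum.inl c) (Sum.inr j) q y
            * curvature (b.prod b') W (Sum.inl a) (Sum.inr i) q (Sum.inl c) y))
      = (f y.1 * (pd b c (hessEndo b G f a c) y.1
          + ∑ d, (christoffel b G c d c y.1 * hessEndo b G f a d y.1
            - christoffel b G c a d y.1 * hessEndo b G f d c y.1))
        - hessEndo b G f a c y.1 * pd b c f y.1) * N y.2 i j := by
    intro c
    rw [h1, Fintype.sum_sum_type]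
    simp only [h.christoffel_lll hy, h.christoffel_lrl hy, h.christoffel_llr hy,
      h.christoffel_lrr hy, h.curvature_lrrl hy, zero_mul, sub_zero, zero_sub, mul_ite, mul_one,
      mul_zero, ite_mul, Finset.sum_sub_distrib, Finset.sum_neg_distrib, Finset.sum_ite_eq,
      Finset.mem_univ, if_true]
    have e1 : ∀ x : ι → ℝ, ∀ z : ι → ℝ, ∑ d, x d * (f y.1 * z d * N y.2 i j)
        = f y.1 * (∑ d, x d * z d) * N y.2 i j := by
      intro x z
      rw [Finset.mul_sum, Finset.sum_mul]
      exact Finset.sum_congr rfl fun _ _ => by ring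
    rw [e1, e1]
    field_simp
    ring
  have hr : ∀ k : κ,
      (pd (b.prod b') (Sum.inr k)
        (curvature (b.prod b') W (Sum.inl a) (Sum.inr i) (Sum.inr j) (Sum.inr k)) y
      + ∑ q, (christoffel (b.prod b') W (Sum.inr k) q (Sum.inr k) y
            * curvature (b.prod b') W (Sum.inl a) (Sum.inr i) (Sum.inr j) q y
        - christoffel (b.prod b') W (Sum.inr k) (Sum.inl a) q y
            * curvature (b.prod b') W q (Sum.inr i) (Sum.inr j) (Sum.inr k) y
        - christoffel (b.prod b') W (Sum.inr k) (Sum.inr i) q y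
            * curvature (b.prod b') W (Sum.inl a) q (Sum.inr j) (Sum.inr k) y
        - christoffel (b.prod b') W (Sum.inr k) (Sum.inr j) q y
            * curvature (b.prod b') W (Sum.inl a) (Sum.inr i) q (Sum.inr k) y))
      = (∑ c, hessEndo b G f a c y.1 * pd b c f y.1) * N y.2 i j
        - pd b a f y.1 / f y.1
          * curvature (b.prod b') W (Sum.inr k) (Sum.inr i) (Sum.inr j) (Sum.inr k) y
        - (∑ c, (grad b G f c y.1 * hess b G f a c y.1))
          * if i = k then N y.2 i j else 0 := by
    intro k
    rw [h2, Fintype.sum_sum_type]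
    simp only [h.christoffel_rll hy, h.christoffel_rlr hy, h.christoffel_rrl hy,
      h.curvature_llrr hy, h.curvature_lrrr hy, h.curvature_lrrl hy, h.curvature_lrlr hy, zero_mul,
      sub_zero, zero_sub, mul_ite, mul_one, mul_zero, ite_mul, Finset.sum_neg_distrib,
      Finset.sum_ite_eq, Finset.mem_univ, if_true, zero_add]
    rw [Finset.sum_sub_distrib, ← sub_eq_add_neg, Finset.sum_mul]
    have e1 : ∑ x, pd b x f y.1 / f y.1 * (f y.1 * hessEndo b G f a x y.1 * N y.2 i j)
        = ∑ c, hessEndo b G f a c y.1 * pd b c f y.1 * N y.2 i j :=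
      Finset.sum_congr rfl fun _ _ => by field_simp
    rw [e1]
    split_ifs with hik
    · subst hik
      rw [Finset.sum_mul]
      have e2 : ∑ x, -(f y.1 * grad b G f x y.1 * N y.2 i j) * -(hess b G f a x y.1 / f y.1)
          = ∑ c, grad b G f c y.1 * hess b G f a c y.1 * N y.2 i j :=
        Finset.sum_congr rfl fun _ _ => by field_simp
      rw [e2]; ring
    · simp
  unfold divCurvature
  rw [Fintype.sum_sum_type, Finset.sum_congr rfl (fun c _ => hl c),
    Finset.sum_congr rfl (fun k _ => hr k), h4, ← Finset.sum_mul, Finset.sum_sub_distrib,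
    Finset.sum_sub_distrib, Finset.sum_sub_distrib]
  simp only [← Finset.mul_sum]
  rw [h3, Finset.sum_ite_eq, if_pos (Finset.mem_univ _), Finset.sum_const, Finset.card_univ,
    nsmul_eq_mul, divHess]
  ring

end IsWarpedOn

end RiemCoord

/-! ### Second-order conditions at a local maximum -/

/-- Write `B` as a sum of rank-one matrices `v vᵀ`; each contributes `v ⬝ A v ≥ 0`. -/
theorem Matrix.PosSemidef.trace_mul_nonneg {ι : Type*} [Fintype ι] [DecidableEq ι]
    {A B : Matrix ι ι ℝ} (hA : A.PosSemidef) (hB : B.PosSemidef) : 0 ≤ (A * B).trace := by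
  obtain ⟨m, v, rfl⟩ := Matrix.posSemidef_iff_eq_sum_vecMulVec.mp hB
  simp only [Matrix.mul_sum, Matrix.trace_sum, Matrix.mul_vecMulVec, Matrix.trace_vecMulVec]
  exact Finset.sum_nonneg fun i _ => by
    rw [dotProduct_comm]; exact hA.dotProduct_mulVec_nonneg (v i)

/-- A positive second derivative would make the point a local minimum as well. The function would
then be locally constant, with zero second derivative. -/
theorem IsLocalMax.deriv_deriv_nonpos {g : ℝ → ℝ} {t : ℝ} (h : IsLocalMax g t)
    (hc : ContinuousAt g t) : deriv (deriv g) t ≤ 0 := by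
  by_contra! hpos
  have hmin : IsLocalMin g t := isLocalMin_of_deriv_deriv_pos hpos h.deriv_eq_zero hc
  have hconst : g =ᶠ[nhds t] fun _ => g t := by
    filter_upwards [h, hmin] with s h1 h2 using le_antisymm h1 h2
  have h2 : deriv g =ᶠ[nhds t] fun _ => 0 := by
    filter_upwards [hconst.eventuallyEq_nhds] with s hs
    rw [hs.deriv_eq, deriv_const]
  rw [h2.deriv_eq, deriv_const] at hpos
  exact lt_irrefl _ hpos

theorem IsLocalMax.fderiv_fderiv_nonpos {E : Type*} [NormedAddCommGroup E] [NormedSpace ℝ E]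
    {v : E → ℝ} {y : E} (h : IsLocalMax v y) (hv : ContDiffAt ℝ 2 v y) (w : E) :
    fderiv ℝ (fderiv ℝ v) y w w ≤ 0 := by
  set γ : ℝ → E := fun t => y + t • w with hγ
  have hγ0 : γ 0 = y := by simp [hγ]
  have hγc : Continuous γ := by fun_prop
  have hγd : ∀ t, HasDerivAt γ w t := fun t => by
    simpa [hγ] using ((hasDerivAt_id t).smul_const w).const_add y
  have hev : ∀ᶠ z in nhds y, DifferentiableAt ℝ v z := by
    filter_upwards [hv.eventually (by simp)] with z hz using hz.differentiableAt (by simp)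
  have hd1 : deriv (v ∘ γ) =ᶠ[nhds 0] fun t => fderiv ℝ v (γ t) w := by
    have : ∀ᶠ t in nhds (0 : ℝ), DifferentiableAt ℝ v (γ t) :=
      hγc.continuousAt.eventually (by rwa [hγ0])
    filter_upwards [this] with t ht using (ht.hasFDerivAt.comp_hasDerivAt t (hγd t)).deriv
  have hd2 : HasFDerivAt (fderiv ℝ v) (fderiv ℝ (fderiv ℝ v) y) (γ 0) := by
    rw [hγ0]
    exact ((hv.fderiv_right (m := 1) (by norm_num)).differentiableAt (by simp)).hasFDerivAt
  have hdd : deriv (deriv (v ∘ γ)) 0 = fderiv ℝ (fderiv ℝ v) y w w := by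
    rw [hd1.deriv_eq]
    simpa using ((hd2.comp_hasDerivAt 0 (hγd 0)).clm_apply (hasDerivAt_const 0 w)).deriv
  rw [← hdd]
  apply IsLocalMax.deriv_deriv_nonpos
  · exact IsLocalMax.comp_continuous (by rwa [hγ0]) hγc.continuousAt
  · exact ContinuousAt.comp (by rw [hγ0]; exact hv.continuousAt) hγc.continuousAt

/-! ### Bochner's formula and the pointwise estimate at a maximum -/

namespace RiemCoord.IsMetricOn

variable {E : Type*} [NormedAddCommGroup E] [NormedSpace ℝ E] {ι : Type*} [Fintype ι]
  [DecidableEq ι] {b : Module.Basis ι ℝ E} {G : E → Matrix ι ι ℝ} {U : Set E} {f v : E → ℝ} {y : E}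

theorem gradSq_nonneg (hG : IsMetricOn G U) (hy : y ∈ U) : 0 ≤ gradSq b G f y := by
  have := (hG.posDef y hy).inv.posSemidef.dotProduct_mulVec_nonneg (fun l => pd b l f y)
  simpa [gradSq, grad, dotProduct, Matrix.mulVec, mul_comm] using this

/-- At a local maximum, the Laplacian is nonpositive. -/
theorem sum_pd_grad_nonpos (hG : IsMetricOn G U) (hv : ContDiffOn ℝ ∞ v U) (hy : y ∈ U)
    (hmax : IsLocalMax v y) : ∑ c, pd b c (grad b G v c) y ≤ 0 := by
  have hd : ∀ {h : E → ℝ}, ContDiffOn ℝ ∞ h U → DifferentiableAt ℝ h y :=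
    fun hh => differentiableAt_of_contDiffOn hG.isOpen hh hy
  -- The first derivatives vanish at `y`, so derivatives of the inverse metric drop out and only the
  -- trace of `G⁻¹` against the second derivatives is left.
  have h0 : ∀ l, pd b l v y = 0 := fun l => by simp [pd, hmax.fderiv_eq_zero]
  have h1 : ∀ c, pd b c (grad b G v c) y = ∑ l, (G y)⁻¹ c l * pd b c (pd b l v) y := by
    intro c
    unfold grad
    rw [pd_sum]
    · refine Finset.sum_congr rfl fun l _ => ?_
      rw [pd_mul (hd (hG.smooth_inv c l)) (hd (contDiffOn_pd hG.isOpen hv)), h0]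
      ring
    · exact fun l _ => (hd (hG.smooth_inv c l)).mul (hd (contDiffOn_pd hG.isOpen hv))
  set D : Matrix ι ι ℝ := Matrix.of fun k l => - pd b k (pd b l v) y with hD
  have hDpos : D.PosSemidef := by
    refine Matrix.PosSemidef.of_dotProduct_mulVec_nonneg ?_ fun x => ?_
    · ext k l
      simpa [hD] using pd_pd_comm hG.isOpen hv hy k
    · have := hmax.fderiv_fderiv_nonpos
        ((hv.contDiffAt (hG.isOpen.mem_nhds hy)).of_le
          (WithTop.coe_le_coe.2 (le_top (a := (2 : ℕ∞))))) (∑ k, x k • b k)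
      simp only [map_sum, map_smul, sum_apply, smul_apply,
        ← pd_pd_eq hG.isOpen hv hy, smul_eq_mul] at this
      simp only [hD, dotProduct, Matrix.mulVec, star_trivial, Matrix.of_apply]
      simp only [neg_mul, Finset.sum_neg_distrib, mul_neg, Finset.mul_sum] at this ⊢
      rw [Left.nonneg_neg_iff, Finset.sum_comm]
      refine le_of_eq_of_le ?_ this
      refine Finset.sum_congr rfl fun k _ => Finset.sum_congr rfl fun l _ => ?_
      ring
  have := (hG.posDef y hy).inv.posSemidef.trace_mul_nonneg hDpos
  simp only [Matrix.trace, Matrix.diag_apply, Matrix.mul_apply, hD, Matrix.of_apply, mul_neg,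
    Finset.sum_neg_distrib, Left.nonneg_neg_iff] at this
  simp_rw [h1]
  refine le_of_eq_of_le ?_ this
  refine Finset.sum_congr rfl fun k _ => Finset.sum_congr rfl fun l _ => ?_
  rw [pd_pd_comm hG.isOpen hv hy]

theorem grad_gradSq (hG : IsMetricOn G U) (hf : ContDiffOn ℝ ∞ f U) (hy : y ∈ U) (c : ι) :
    grad b G (gradSq b G f) c y = 2 * ∑ a, grad b G f a y * hessEndo b G f a c y := by
  unfold grad
  simp_rw [hG.pd_gradSq hf hy, ← hG.sum_hess_mul_grad hf hy, hG.hessEndo_eq hf hy, Finset.mul_sum]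
  rw [Finset.sum_comm]
  refine Finset.sum_congr rfl fun a _ => Finset.sum_congr rfl fun l _ => ?_
  rw [hG.hess_symm hf hy l a, grad]
  ring

/-- Bochner's formula. -/
theorem div_sum_grad_mul_hessEndo (hG : IsMetricOn G U) (hf : ContDiffOn ℝ ∞ f U) (hy : y ∈ U) :
    ∑ c, (pd b c (fun z => ∑ a, grad b G f a z * hessEndo b G f a c z) y
      + ∑ d, christoffel b G c d c y * ∑ a, grad b G f a y * hessEndo b G f a d y)
    = ∑ a, grad b G f a y * divHess b G f a y
      + ∑ c, ∑ d, hessEndo b G f c d y * hessEndo b G f d c y := by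
  have hd : ∀ {h : E → ℝ}, ContDiffOn ℝ ∞ h U → DifferentiableAt ℝ h y :=
    fun hh => differentiableAt_of_contDiffOn hG.isOpen hh hy
  have h1 : ∀ c, pd b c (fun z => ∑ a, grad b G f a z * hessEndo b G f a c z) y
      = ∑ a, (pd b c (grad b G f a) y * hessEndo b G f a c y
        + grad b G f a y * pd b c (hessEndo b G f a c) y) := by
    intro c
    rw [pd_sum]
    · exact Finset.sum_congr rfl fun a _ =>
        pd_mul (hd (hG.smooth_grad hf a)) (hd (hG.smooth_hessEndo hf a c))
    · exact fun a _ => (hd (hG.smooth_grad hf a)).mul (hd (hG.smooth_hessEndo hf a c))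
  -- Completing the partial derivative of the gradient to a Hessian costs a Christoffel term,
  -- exactly the one that `divHess` needs for its lower index.
  have h2 : ∀ c d, pd b c (grad b G f d) y * hessEndo b G f d c y
      = hessEndo b G f c d y * hessEndo b G f d c y
        - ∑ a, christoffel b G c a d y * grad b G f a y * hessEndo b G f d c y := by
    intro c d
    rw [← Finset.sum_mul, ← sub_mul]
    unfold hessEndo; ring
  have h3 : ∑ a, grad b G f a y * divHess b G f a y
      = ∑ c, ∑ a, grad b G f a y * pd b c (hessEndo b G f a c) y
        + ∑ c, ∑ d, ∑ a, christoffel b G c d c y * (grad b G f a y * hessEndo b G f a d y)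
        - ∑ c, ∑ d, ∑ a, christoffel b G c a d y * grad b G f a y * hessEndo b G f d c y := by
    have e1 : ∀ F : ι → ι → ι → ℝ, ∑ c, ∑ d, ∑ a, F c d a = ∑ a, ∑ c, ∑ d, F c d a := by
      intro F
      rw [Finset.sum_comm (s := Finset.univ (α := ι)) (f := fun a c => ∑ d, F c d a)]
      exact Finset.sum_congr rfl fun c _ => Finset.sum_comm
    rw [e1 fun c d a => christoffel b G c d c y * (grad b G f a y * hessEndo b G f a d y),
      e1 fun c d a => christoffel b G c a d y * grad b G f a y * hessEndo b G f d c y,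
      Finset.sum_comm, ← Finset.sum_add_distrib, ← Finset.sum_sub_distrib]
    refine Finset.sum_congr rfl fun a _ => ?_
    rw [divHess, Finset.mul_sum, ← Finset.sum_add_distrib, ← Finset.sum_sub_distrib]
    refine Finset.sum_congr rfl fun c _ => ?_
    rw [mul_add, Finset.mul_sum, add_sub_assoc, ← Finset.sum_sub_distrib]
    congr 1
    exact Finset.sum_congr rfl fun d _ => by ring
  simp_rw [h1, h3, Finset.sum_add_distrib, h2, Finset.sum_sub_distrib, Finset.mul_sum]
  ring

/-- The trace of the square of a self-adjoint endomorphism shifted by a multiple of the identity is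
nonnegative. -/
theorem trace_hessEndo_sq_add (hG : IsMetricOn G U) (hf : ContDiffOn ℝ ∞ f U) (hy : y ∈ U)
    (t : ℝ) : 0 ≤ ∑ c, ∑ d, hessEndo b G f c d y * hessEndo b G f d c y
      + 2 * t * ∑ c, hessEndo b G f c c y + t ^ 2 * Fintype.card ι := by
  set h : Matrix ι ι ℝ := Matrix.of fun a c => hess b G f a c y with hh
  set H : Matrix ι ι ℝ := Matrix.of fun a c => hessEndo b G f a c y with hH
  have hHh : H = h * (G y)⁻¹ := by
    ext a c
    simp only [hH, hh, Matrix.of_apply, Matrix.mul_apply, hG.hessEndo_eq hf hy]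
    exact Finset.sum_congr rfl fun e _ => by rw [hG.inv_symm_apply hy, mul_comm]
  -- The claim is `tr ((H + t)²) ≥ 0`, and this trace equals that of `(k G⁻¹ k) G⁻¹`, a product of
  -- two positive semidefinite matrices.
  set k : Matrix ι ι ℝ := h + t • G y with hk
  have hkH : k.IsHermitian := by
    ext i j
    simp [hk, hh, hG.hess_symm hf hy j i, hG.symm_apply hy j i]
  have hkG : k * (G y)⁻¹ = H + t • 1 := by
    rw [hk, add_mul, ← hHh, Matrix.smul_mul, hG.mul_inv hy]
  have h1 : (k * (G y)⁻¹ * k).PosSemidef := by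
    have := (hG.posDef y hy).inv.posSemidef.mul_mul_conjTranspose_same k
    rwa [hkH] at this
  have h2 := h1.trace_mul_nonneg (hG.posDef y hy).inv.posSemidef
  rw [Matrix.mul_assoc, hkG] at h2
  have h3 : (H * H).trace = ∑ c, ∑ d, hessEndo b G f c d y * hessEndo b G f d c y := by
    simp [Matrix.trace, Matrix.mul_apply, hH]
  have h4 : H.trace = ∑ c, hessEndo b G f c c y := by simp [Matrix.trace, hH]
  simp only [add_mul, mul_add, Matrix.trace_add, h3, Matrix.smul_mul, Matrix.mul_smul,
    Matrix.mul_one, Matrix.one_mul, Matrix.trace_smul, h4, Matrix.trace_one, smul_eq_mul] at h2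
  linarith

/-- The exponent 3 makes the estimate work down to `p = 1`. Contracting `hE` with `∇f` and using `∇v
= 0` gives `2⟨∇f, div H⟩ ≥ 3(p - 2) ε f Q`, while `Δ(ε f³)` contributes `6 ε f Q`; the total `3p ε f
Q` is positive when `Q` is. The remaining terms, quadratic and linear in `H`, are bounded below by
completing the square. An exponent 2 would give `p - 1` in place of `p`, up to a positive factor. -/
theorem gradSq_le_of_isLocalMax (hG : IsMetricOn G U) (hf : ContDiffOn ℝ ∞ f U) (hy : y ∈ U)
    (hpos : 0 < f y) {p κ ε : ℝ} (hp : 1 ≤ p) (hκ : κ ≤ 0) (hε : 0 < ε)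
    (hE : ∀ a, f y * divHess b G f a y + (p - 2) * ∑ c, hessEndo b G f a c y * pd b c f y
      - (p - 1) * gradSq b G f y * (pd b a f y / f y) + pd b a f y / f y * κ = 0)
    (hmax : IsLocalMax (fun z => gradSq b G f z + ε * f z ^ 3) y) :
    gradSq b G f y ≤ Fintype.card ι * (ε * f y ^ 3) := by
  have hd : ∀ {h : E → ℝ} {z : E}, ContDiffOn ℝ ∞ h U → z ∈ U → DifferentiableAt ℝ h z :=
    fun hh hz => differentiableAt_of_contDiffOn hG.isOpen hh hz
  have hf3 : ContDiffOn ℝ ∞ (fun z => ε * f z ^ 3) U := contDiffOn_const.mul (hf.pow 3)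
  have hv : ContDiffOn ℝ ∞ (fun z => gradSq b G f z + ε * f z ^ 3) U :=
    (hG.smooth_gradSq hf).add hf3
  have hX : ∀ c, ContDiffOn ℝ ∞ (fun z => ∑ a, grad b G f a z * hessEndo b G f a c z) U := fun c =>
    ContDiffOn.sum fun a _ => (hG.smooth_grad hf a).mul (hG.smooth_hessEndo hf a c)
  have hpdf3 : ∀ z ∈ U, ∀ l, pd b l (fun z => ε * f z ^ 3) z = 3 * ε * f z ^ 2 * pd b l f z := by
    intro z hz l
    have := (((hd hf hz).hasFDerivAt.pow 3).const_mul ε).fderiv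
    simp only [pd, this]
    simp
    ring
  have hgrad : ∀ z ∈ U, ∀ c, grad b G (fun z => gradSq b G f z + ε * f z ^ 3) c z
      = 2 * (∑ a, grad b G f a z * hessEndo b G f a c z)
        + 3 * ε * f z ^ 2 * grad b G f c z := by
    intro z hz c
    rw [← hG.grad_gradSq hf hz]
    simp only [grad, Finset.mul_sum, ← Finset.sum_add_distrib]
    refine Finset.sum_congr rfl fun l _ => ?_
    rw [pd_add (hd (hG.smooth_gradSq hf) hz) (hd hf3 hz), hpdf3 z hz]
    ring
  have hgrad0 : ∀ c, 2 * (∑ a, grad b G f a y * hessEndo b G f a c y)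
        + 3 * ε * f y ^ 2 * grad b G f c y = 0 := by
    intro c
    rw [← hgrad y hy]
    simp [grad, pd, hmax.fderiv_eq_zero]
  have hlap := hG.sum_pd_grad_nonpos (b := b) hv hy hmax
  have hpdgrad : ∀ c, pd b c (grad b G (fun z => gradSq b G f z + ε * f z ^ 3) c) y
      = 2 * pd b c (fun z => ∑ a, grad b G f a z * hessEndo b G f a c z) y
        + 3 * ε * (2 * f y * (grad b G f c y * pd b c f y)
          + f y ^ 2 * pd b c (grad b G f c) y) := by
    intro c
    have hff : ContDiffOn ℝ ∞ (fun z => 3 * ε * (f z * f z)) U := contDiffOn_const.mul (hf.mul hf)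
    rw [pd_congr hG.isOpen (g := fun z => 2 * (∑ a, grad b G f a z * hessEndo b G f a c z)
        + 3 * ε * (f z * f z) * grad b G f c z)
        (fun z hz => by rw [hgrad z hz c]; ring) hy,
      pd_add (hd (contDiffOn_const.mul (hX c)) hy) (hd (hff.mul (hG.smooth_grad hf c)) hy),
      pd_mul (by fun_prop) (hd (hX c) hy), pd_mul (hd hff hy) (hd (hG.smooth_grad hf c) hy),
      pd_mul (by fun_prop) (hd (hf.mul hf) hy), pd_mul (hd hf hy) (hd hf hy), pd_const, pd_const]
    ring
  -- The gradient of `v` is zero at `y`, so Christoffel terms may be added freely to turn the sum of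
  -- partial derivatives into a divergence.
  have hdiv : ∀ c, ∑ d, christoffel b G c d c y * (2 * (∑ a, grad b G f a y * hessEndo b G f a d y)
        + 3 * ε * f y ^ 2 * grad b G f d y) = 0 := fun c => by simp [hgrad0]
  have hB := hG.div_sum_grad_mul_hessEndo (b := b) hf hy
  -- This shift `t` satisfies `4 t = 3 ε f²`, so twice the inequality bounds `2 tr H² + 3 ε f² tr H`
  -- from below by `-2 t² m`.
  have hT := hG.trace_hessEndo_sq_add (b := b) hf hy (3 / 4 * ε * f y ^ 2)
  have hQ := hG.gradSq_nonneg (b := b) (f := f) hy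
  have e1 : 2 * ((∑ a, grad b G f a y * divHess b G f a y)
        + ∑ c, ∑ d, hessEndo b G f c d y * hessEndo b G f d c y)
      + 3 * ε * (f y ^ 2 * ∑ c, hessEndo b G f c c y + 2 * f y * gradSq b G f y) ≤ 0 := by
    have hT' : ∑ c, hessEndo b G f c c y = ∑ c, pd b c (grad b G f c) y
        + ∑ c, ∑ d, christoffel b G c d c y * grad b G f d y := by
      simp only [hessEndo, Finset.sum_add_distrib]
    have hdiv' : 2 * (∑ c, ∑ d, christoffel b G c d c y
          * ∑ a, grad b G f a y * hessEndo b G f a d y)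
        + 3 * ε * f y ^ 2 * ∑ c, ∑ d, christoffel b G c d c y * grad b G f d y = 0 := by
      rw [← Finset.sum_eq_zero fun c _ => hdiv c]
      rw [Finset.mul_sum, Finset.mul_sum, ← Finset.sum_add_distrib]
      refine Finset.sum_congr rfl fun c _ => ?_
      rw [Finset.mul_sum, Finset.mul_sum, ← Finset.sum_add_distrib]
      refine Finset.sum_congr rfl fun d _ => ?_
      ring
    have hlap' : 2 * (∑ c, pd b c (fun z => ∑ a, grad b G f a z * hessEndo b G f a c z) y)
        + 3 * ε * (2 * f y * gradSq b G f y + f y ^ 2 * ∑ c, pd b c (grad b G f c) y) ≤ 0 := by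
      refine le_of_eq_of_le ?_ hlap
      rw [Finset.sum_congr rfl fun c _ => hpdgrad c]
      simp only [Finset.sum_add_distrib, ← Finset.mul_sum]
      rfl
    rw [← hB, hT', Finset.sum_add_distrib]
    linear_combination hlap' + hdiv'
  have e3 : 2 * (∑ a, grad b G f a y * ∑ c, hessEndo b G f a c y * pd b c f y)
      + 3 * ε * f y ^ 2 * gradSq b G f y = 0 := by
    have : ∑ c, (2 * (∑ a, grad b G f a y * hessEndo b G f a c y)
        + 3 * ε * f y ^ 2 * grad b G f c y) * pd b c f y = 0 := by simp [hgrad0]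
    rw [← this]
    simp only [gradSq, Finset.mul_sum, add_mul, Finset.sum_add_distrib, Finset.sum_mul]
    rw [Finset.sum_comm]
    congr 1
    · exact Finset.sum_congr rfl fun c _ => Finset.sum_congr rfl fun a _ => by ring
    · exact Finset.sum_congr rfl fun c _ => by ring
  have e2 : f y * (∑ a, grad b G f a y * divHess b G f a y)
      + (p - 2) * (∑ a, grad b G f a y * ∑ c, hessEndo b G f a c y * pd b c f y)
      - (p - 1) * gradSq b G f y * (gradSq b G f y / f y) + gradSq b G f y / f y * κ = 0 := by
    have : ∑ a, grad b G f a y * (f y * divHess b G f a y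
        + (p - 2) * ∑ c, hessEndo b G f a c y * pd b c f y
        - (p - 1) * gradSq b G f y * (pd b a f y / f y) + pd b a f y / f y * κ) = 0 := by
      simp [hE]
    rw [← this]
    have hq : gradSq b G f y / f y = ∑ a, grad b G f a y * (pd b a f y / f y) := by
      rw [gradSq, Finset.sum_div]
      exact Finset.sum_congr rfl fun a _ => by ring
    rw [hq, Finset.mul_sum, Finset.mul_sum, Finset.mul_sum, Finset.sum_mul,
      ← Finset.sum_add_distrib, ← Finset.sum_sub_distrib, ← Finset.sum_add_distrib]
    exact Finset.sum_congr rfl fun a _ => by ring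
  have hm : (0 : ℝ) ≤ Fintype.card ι := Nat.cast_nonneg _
  generalize (∑ a, grad b G f a y * divHess b G f a y) = A at *
  generalize (∑ a, grad b G f a y * ∑ c, hessEndo b G f a c y * pd b c f y) = XF at *
  generalize (∑ c, ∑ d, hessEndo b G f c d y * hessEndo b G f d c y) = T2 at *
  generalize (∑ c, hessEndo b G f c c y) = T at *
  generalize gradSq b G f y = Q at *
  generalize (Fintype.card ι : ℝ) = m at *
  generalize f y = F at *
  have hXF : XF = - (3 / 2) * ε * F ^ 2 * Q := by linarith
  -- Solving `e2` for `F * A` leaves two further terms, `(p - 1) Q² / F` and `-κ Q / F`. Both are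
  -- nonnegative, the second because `κ ≤ 0`, and they are discarded.
  have hA : 3 / 2 * (p - 2) * ε * F * Q ≤ A := by
    refine le_of_mul_le_mul_left ?_ hpos
    have hQF : 0 ≤ Q / F := by positivity
    have h1 : 0 ≤ (p - 1) * Q * (Q / F) := mul_nonneg (mul_nonneg (by linarith) hQ) hQF
    have h2 : Q / F * κ ≤ 0 := mul_nonpos_of_nonneg_of_nonpos hQF hκ
    rw [hXF] at e2
    linarith
  have h3 : 0 ≤ (p - 1) * (ε * F * Q) := mul_nonneg (by linarith) (by positivity)
  have h4 : 0 ≤ m * (ε * F) * (ε * F ^ 3) := by positivity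
  -- Collected, the inequalities read `3p ε F Q ≤ (9/8) m ε² F⁴`; `h3` and `h4` weaken this to the
  -- stated constant.
  refine le_of_mul_le_mul_left ?_ (mul_pos hε hpos)
  linarith

end RiemCoord.IsMetricOn

open RiemCoord

/-! ### The metric and the gradient norm in charts of a manifold -/

/-- Completing the square: the maximum is attained at `A⁻¹ l`. Expressing the dual norm as a
supremum over vectors makes it independent of the chart, as needed to compare its values across the
manifold. -/
theorem Matrix.PosDef.isGreatest_range {ι : Type*} [Fintype ι] [DecidableEq ι] {A : Matrix ι ι ℝ}
    (hA : A.PosDef) (l : ι → ℝ) :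
    IsGreatest (Set.range fun v : ι → ℝ => 2 * (l ⬝ᵥ v) - v ⬝ᵥ A.mulVec v)
      (l ⬝ᵥ A⁻¹.mulVec l) := by
  have hdet : IsUnit A.det := isUnit_iff_ne_zero.mpr hA.det_pos.ne'
  have hAl : A.mulVec (A⁻¹.mulVec l) = l := by
    rw [Matrix.mulVec_mulVec, Matrix.mul_nonsing_inv _ hdet, Matrix.one_mulVec]
  have hsymm : ∀ u v : ι → ℝ, u ⬝ᵥ A.mulVec v = v ⬝ᵥ A.mulVec u := by
    intro u v
    have hT : A.transpose = A := by simpa using hA.isHermitian.eq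
    rw [Matrix.dotProduct_mulVec, ← Matrix.mulVec_transpose, hT, dotProduct_comm]
  refine ⟨⟨A⁻¹.mulVec l, ?_⟩, ?_⟩
  · simp only [hAl]
    rw [dotProduct_comm (A⁻¹.mulVec l) l]
    ring
  · rintro _ ⟨v, rfl⟩
    have h := hA.posSemidef.dotProduct_mulVec_nonneg (v - A⁻¹.mulVec l)
    simp only [star_trivial, Matrix.mulVec_sub, sub_dotProduct, dotProduct_sub, hAl] at h
    rw [hsymm (A⁻¹.mulVec l) v, hAl, dotProduct_comm v l, dotProduct_comm (A⁻¹.mulVec l) l] at h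
    simp only
    linarith

theorem ContinuousLinearMap.dotProduct_mulVec_of {ι E F : Type*} [Fintype ι]
    [AddCommGroup E] [Module ℝ E] [TopologicalSpace E] [AddCommGroup F] [Module ℝ F]
    [TopologicalSpace F] (B : F →L[ℝ] F →L[ℝ] ℝ) (L : E →L[ℝ] F) (c : ι → E) (u v : ι → ℝ) :
    u ⬝ᵥ (Matrix.of fun i j => B (L (c i)) (L (c j))).mulVec v
      = B (L (∑ i, u i • c i)) (L (∑ i, v i • c i)) := by
  simp only [dotProduct, Matrix.mulVec, Matrix.of_apply]
  rw [map_sum L, map_sum L, map_sum B, sum_apply]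
  refine Finset.sum_congr rfl fun i _ => ?_
  rw [map_sum, Finset.mul_sum]
  refine Finset.sum_congr rfl fun j _ => ?_
  rw [map_smul L, map_smul L, map_smul B, map_smul, smul_apply, smul_eq_mul, smul_eq_mul]
  ring

section Charts

variable {n : ℕ} {M : Type*} [TopologicalSpace M] [ChartedSpace (EuclideanSpace ℝ (Fin n)) M]
  [IsManifold (𝓡 n) ∞ M] {x₀ : M} {y : EuclideanSpace ℝ (Fin n)}

theorem mdifferentiableAt_chart_symm (hy : y ∈ (extChartAt (𝓡 n) x₀).target) :
    MDifferentiableAt 𝓘(ℝ, EuclideanSpace ℝ (Fin n)) (𝓡 n) (extChartAt (𝓡 n) x₀).symm y :=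
  ((contMDiffOn_extChartAt_symm (n := ∞) x₀).contMDiffAt
    ((isOpen_extChartAt_target x₀).mem_nhds hy)).mdifferentiableAt (by simp)

theorem isInvertible_mfderiv_chart_symm (hy : y ∈ (extChartAt (𝓡 n) x₀).target) :
    (mfderiv 𝓘(ℝ, EuclideanSpace ℝ (Fin n)) (𝓡 n) (extChartAt (𝓡 n) x₀).symm y).IsInvertible := by
  have : IsManifold (𝓡 n) 1 M := IsManifold.of_le (n := ∞) (by simp)
  have h := isInvertible_mfderivWithin_extChartAt_symm (I := 𝓡 n) hy
  simpa [mfderivWithin_univ] using h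

/-- A linear combination of the coordinate vector fields is smooth. -/
theorem contMDiffOn_mfderiv_chart_symm (x₀ : M) (w : EuclideanSpace ℝ (Fin n)) :
    ContMDiffOn 𝓘(ℝ, EuclideanSpace ℝ (Fin n)) (𝓡 n).tangent ∞
      (fun y => (Bundle.TotalSpace.mk' (EuclideanSpace ℝ (Fin n)) ((extChartAt (𝓡 n) x₀).symm y)
        (mfderiv 𝓘(ℝ, EuclideanSpace ℝ (Fin n)) (𝓡 n) (extChartAt (𝓡 n) x₀).symm y w) :
          TangentBundle (𝓡 n) M))
      (extChartAt (𝓡 n) x₀).target := by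
  have ho : IsOpen (extChartAt (𝓡 n) x₀).target := isOpen_extChartAt_target x₀
  have h1 := (contMDiffOn_extChartAt_symm (n := ∞) (I := 𝓡 n) x₀).contMDiffOn_tangentMapWithin
    (m := ∞) (by simp) ho.uniqueMDiffOn
  have h2 : ContMDiff 𝓘(ℝ, EuclideanSpace ℝ (Fin n)) 𝓘(ℝ, EuclideanSpace ℝ (Fin n)).tangent ∞
      (fun y : EuclideanSpace ℝ (Fin n) => (Bundle.TotalSpace.mk' (EuclideanSpace ℝ (Fin n)) y w :
        TangentBundle 𝓘(ℝ, EuclideanSpace ℝ (Fin n)) (EuclideanSpace ℝ (Fin n)))) :=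
    contMDiff_vectorSpace_iff_contDiff.2 contDiff_const
  refine (h1.comp h2.contMDiffOn fun y hy => hy).congr fun y hy => ?_
  simp only [Function.comp_apply, tangentMapWithin]
  rw [mfderivWithin_of_isOpen ho hy]

theorem contDiffOn_comp_chart_symm {φ : M → ℝ} (hφ : ContMDiff (𝓡 n) 𝓘(ℝ, ℝ) ∞ φ) (x₀ : M) :
    ContDiffOn ℝ ∞ (φ ∘ (extChartAt (𝓡 n) x₀).symm) (extChartAt (𝓡 n) x₀).target := by
  rw [← contMDiffOn_iff_contDiffOn]
  exact hφ.comp_contMDiffOn (contMDiffOn_extChartAt_symm x₀)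

theorem mfderiv_mfderiv_chart_symm {φ : M → ℝ} (hφ : ContMDiff (𝓡 n) 𝓘(ℝ, ℝ) ∞ φ)
    (hy : y ∈ (extChartAt (𝓡 n) x₀).target) (w : EuclideanSpace ℝ (Fin n)) :
    mfderiv (𝓡 n) 𝓘(ℝ, ℝ) φ ((extChartAt (𝓡 n) x₀).symm y)
      (mfderiv 𝓘(ℝ, EuclideanSpace ℝ (Fin n)) (𝓡 n) (extChartAt (𝓡 n) x₀).symm y w)
      = fderiv ℝ (φ ∘ (extChartAt (𝓡 n) x₀).symm) y w := by
  rw [← mfderiv_eq_fderiv, mfderiv_comp y (hφ.mdifferentiableAt (by simp))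
    (mdifferentiableAt_chart_symm hy)]
  rfl

theorem dotProduct_metricComponents_mulVec (g : SmoothMetric n M) (x₀ : M)
    (y : EuclideanSpace ℝ (Fin n)) (u v : Fin n → ℝ) :
    u ⬝ᵥ (metricComponents (𝓡 n) (stdBasis n) g.tensor x₀ y).mulVec v
      = g.tensor ((extChartAt (𝓡 n) x₀).symm y)
        (mfderiv 𝓘(ℝ, EuclideanSpace ℝ (Fin n)) (𝓡 n) (extChartAt (𝓡 n) x₀).symm y
          (∑ i, u i • stdBasis n i))
        (mfderiv 𝓘(ℝ, EuclideanSpace ℝ (Fin n)) (𝓡 n) (extChartAt (𝓡 n) x₀).symm y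
          (∑ i, v i • stdBasis n i)) := by
  exact ContinuousLinearMap.dotProduct_mulVec_of (g.inner ((extChartAt (𝓡 n) x₀).symm y))
    (mfderiv 𝓘(ℝ, EuclideanSpace ℝ (Fin n)) (𝓡 n) (extChartAt (𝓡 n) x₀).symm y) (stdBasis n) u v

theorem isMetricOn_metricComponents (g : SmoothMetric n M) (x₀ : M) :
    IsMetricOn (metricComponents (𝓡 n) (stdBasis n) g.tensor x₀) (extChartAt (𝓡 n) x₀).target where
  isOpen := isOpen_extChartAt_target x₀
  smooth i j := by
    rw [← contMDiffOn_iff_contDiffOn]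
    have h1 := ContMDiffOn.clm_bundle_apply₂ (F₁ := EuclideanSpace ℝ (Fin n))
      (F₂ := EuclideanSpace ℝ (Fin n)) (F₃ := ℝ) (E₃ := Bundle.Trivial M ℝ) (n := ∞)
      (b := (extChartAt (𝓡 n) x₀).symm)
      (g.contMDiff.comp_contMDiffOn (contMDiffOn_extChartAt_symm (n := ∞) x₀))
      (contMDiffOn_mfderiv_chart_symm x₀ (stdBasis n i))
      (contMDiffOn_mfderiv_chart_symm x₀ (stdBasis n j))
    intro y hy
    have h2 := h1 y hy
    rw [Bundle.contMDiffWithinAt_totalSpace] at h2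
    exact h2.2
  posDef y hy := by
    refine Matrix.PosDef.of_dotProduct_mulVec_pos ?_ fun v hv => ?_
    · ext i j
      exact g.symm _ _ _
    · rw [star_trivial, dotProduct_metricComponents_mulVec]
      apply g.pos
      intro h0
      have h1 := (isInvertible_mfderiv_chart_symm hy).injective (h0.trans (map_zero _).symm)
      have h2 : (∑ i, v i • stdBasis n i : EuclideanSpace ℝ (Fin n)) = 0 := h1
      apply hv
      rw [← (stdBasis n).repr_sum_self v, h2, map_zero]
      rfl

/-- The squared length of the differential of `φ`, characterized without reference to charts. -/
def gradNormSq (g : SmoothMetric n M) (φ : M → ℝ) (x : M) : ℝ :=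
  sSup (Set.range fun v : TangentSpace (𝓡 n) x =>
    2 * (show ℝ from mfderiv (𝓡 n) 𝓘(ℝ, ℝ) φ x v) - g.tensor x v v)

/-- The coordinate vector fields span each tangent space, so the supremum over tangent vectors is
one over coefficient vectors, which `Matrix.PosDef.isGreatest_range` evaluates. -/
theorem gradNormSq_chart_symm (g : SmoothMetric n M) {φ : M → ℝ}
    (hφ : ContMDiff (𝓡 n) 𝓘(ℝ, ℝ) ∞ φ) (hy : y ∈ (extChartAt (𝓡 n) x₀).target) :
    gradNormSq g φ ((extChartAt (𝓡 n) x₀).symm y)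
      = gradSq (stdBasis n) (metricComponents (𝓡 n) (stdBasis n) g.tensor x₀)
        (φ ∘ (extChartAt (𝓡 n) x₀).symm) y := by
  set L := mfderiv 𝓘(ℝ, EuclideanSpace ℝ (Fin n)) (𝓡 n) (extChartAt (𝓡 n) x₀).symm y with hL
  set f := φ ∘ (extChartAt (𝓡 n) x₀).symm with hf
  have hG := (isMetricOn_metricComponents g x₀).posDef y hy
  have hsurj : Function.Surjective fun v : Fin n → ℝ => L (∑ i, v i • stdBasis n i) := by
    intro w
    obtain ⟨z, hz⟩ := (isInvertible_mfderiv_chart_symm hy).surjective w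
    refine ⟨fun i => (stdBasis n).repr z i, ?_⟩
    exact (congrArg (fun q : EuclideanSpace ℝ (Fin n) => L q) ((stdBasis n).sum_repr z)).trans hz
  have hrange : (Set.range fun v : TangentSpace (𝓡 n) ((extChartAt (𝓡 n) x₀).symm y) =>
      2 * (show ℝ from mfderiv (𝓡 n) 𝓘(ℝ, ℝ) φ ((extChartAt (𝓡 n) x₀).symm y) v)
        - g.tensor ((extChartAt (𝓡 n) x₀).symm y) v v)
      = Set.range fun v : Fin n → ℝ => 2 * ((fun i => pd (stdBasis n) i f y) ⬝ᵥ v)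
        - v ⬝ᵥ (metricComponents (𝓡 n) (stdBasis n) g.tensor x₀ y).mulVec v := by
    rw [← hsurj.range_comp]
    congr 1
    funext v
    rw [dotProduct_metricComponents_mulVec]
    have h1 := mfderiv_mfderiv_chart_symm hφ hy (∑ i, v i • stdBasis n i)
    have h2 : fderiv ℝ f y (∑ i, v i • stdBasis n i) = (fun i => pd (stdBasis n) i f y) ⬝ᵥ v := by
      rw [map_sum]
      refine Finset.sum_congr rfl fun i _ => ?_
      rw [map_smul, smul_eq_mul, mul_comm]
      rfl
    rw [← h2, ← h1]
    rfl
  unfold gradNormSq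
  rw [hrange, (hG.isGreatest_range _).csSup_eq]
  simp [gradSq, grad, dotProduct, Matrix.mulVec, mul_comm]

theorem continuous_gradNormSq (g : SmoothMetric n M) {φ : M → ℝ}
    (hφ : ContMDiff (𝓡 n) 𝓘(ℝ, ℝ) ∞ φ) : Continuous (gradNormSq g φ) := by
  rw [continuous_iff_continuousAt]
  intro x
  have hy : extChartAt (𝓡 n) x x ∈ (extChartAt (𝓡 n) x).target := mem_extChartAt_target x
  have h1 : ContinuousAt (gradSq (stdBasis n) (metricComponents (𝓡 n) (stdBasis n) g.tensor x)
      (φ ∘ (extChartAt (𝓡 n) x).symm)) (extChartAt (𝓡 n) x x) :=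
    (((isMetricOn_metricComponents g x).smooth_gradSq
      (contDiffOn_comp_chart_symm hφ x)).continuousOn).continuousAt
      ((isOpen_extChartAt_target x).mem_nhds hy)
  refine (h1.comp (continuousAt_extChartAt x)).congr ?_
  filter_upwards [extChartAt_source_mem_nhds (I := 𝓡 n) x] with z hz
  have := gradNormSq_chart_symm g hφ ((extChartAt (𝓡 n) x).map_source hz)
  rw [(extChartAt (𝓡 n) x).left_inv hz] at this
  exact this.symm

/-- A function on a connected manifold all of whose partial derivatives in charts vanish is
constant. -/
theorem exists_pd_ne_zero [ConnectedSpace M] {φ : M → ℝ} (hφ : ContMDiff (𝓡 n) 𝓘(ℝ, ℝ) ∞ φ)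
    (hnc : ∃ x x' : M, φ x ≠ φ x') :
    ∃ x₀ : M, ∃ y ∈ (extChartAt (𝓡 n) x₀).target, ∃ a,
      pd (stdBasis n) a (φ ∘ (extChartAt (𝓡 n) x₀).symm) y ≠ 0 := by
  by_contra! h
  obtain ⟨x, x', hxx'⟩ := hnc
  apply hxx'
  refine IsLocallyConstant.apply_eq_of_preconnectedSpace ?_ x x'
  rw [IsLocallyConstant.iff_eventually_eq]
  intro x₀
  set f := φ ∘ (extChartAt (𝓡 n) x₀).symm with hf
  have ho : IsOpen (extChartAt (𝓡 n) x₀).target := isOpen_extChartAt_target x₀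
  have hd : ∀ y ∈ (extChartAt (𝓡 n) x₀).target, fderiv ℝ f y = 0 := fun y hy =>
    ContinuousLinearMap.coe_injective ((stdBasis n).ext fun a => h x₀ y hy a)
  obtain ⟨r, hr, hball⟩ := Metric.isOpen_iff.1 ho _ (mem_extChartAt_target (I := 𝓡 n) x₀)
  have hc : ∀ y ∈ Metric.ball (extChartAt (𝓡 n) x₀ x₀) r, f y = f (extChartAt (𝓡 n) x₀ x₀) :=
    fun y hy => Metric.isOpen_ball.is_const_of_fderiv_eq_zero
      (convex_ball _ _).isPreconnected
      (((contDiffOn_comp_chart_symm hφ x₀).differentiableOn (by simp)).mono hball)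
      (fun z hz => hd z (hball hz)) hy (Metric.mem_ball_self hr)
  filter_upwards [extChartAt_source_mem_nhds (I := 𝓡 n) x₀,
    (continuousAt_extChartAt (I := 𝓡 n) x₀).preimage_mem_nhds (Metric.ball_mem_nhds _ hr)]
    with z hz hz'
  have := hc _ hz'
  rwa [hf, Function.comp_apply, Function.comp_apply, (extChartAt (𝓡 n) x₀).left_inv hz,
    extChartAt_to_inv] at this

end Charts

/-! ### The maximum principle on the compact base -/

section MaximumPrinciple

variable {n : ℕ} {M : Type*} [TopologicalSpace M] [ChartedSpace (EuclideanSpace ℝ (Fin n)) M]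
  [IsManifold (𝓡 n) ∞ M]

theorem SmoothMetric.tensor_zero_left (g : SmoothMetric n M) (x : M) (v : TangentSpace (𝓡 n) x) :
    g.tensor x 0 v = 0 := by
  simp [SmoothMetric.tensor]

theorem SmoothMetric.tensor_zero_right (g : SmoothMetric n M) (x : M) (v : TangentSpace (𝓡 n) x) :
    g.tensor x v 0 = 0 := by
  simp [SmoothMetric.tensor]

theorem gradNormSq_nonneg (g : SmoothMetric n M) {φ : M → ℝ}
    (hφ : ContMDiff (𝓡 n) 𝓘(ℝ, ℝ) ∞ φ) (x : M) : 0 ≤ gradNormSq g φ x := by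
  have := gradNormSq_chart_symm g hφ (mem_extChartAt_target (I := 𝓡 n) x)
  rw [extChartAt_to_inv] at this
  rw [this]
  exact (isMetricOn_metricComponents g x).gradSq_nonneg (mem_extChartAt_target x)

theorem eq_of_gradNormSq_eq_zero [ConnectedSpace M] (g : SmoothMetric n M) {φ : M → ℝ}
    (hφ : ContMDiff (𝓡 n) 𝓘(ℝ, ℝ) ∞ φ) (h0 : ∀ x, gradNormSq g φ x = 0) (x x' : M) :
    φ x = φ x' := by
  by_contra hne
  obtain ⟨x₀, y, hy, a, ha⟩ := exists_pd_ne_zero hφ ⟨x, x', hne⟩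
  apply ha
  set l : Fin n → ℝ := fun i => pd (stdBasis n) i (φ ∘ (extChartAt (𝓡 n) x₀).symm) y with hl
  have h1 := gradNormSq_chart_symm g hφ hy
  rw [h0] at h1
  by_contra hla
  have hl0 : l ≠ 0 := fun h => hla (congrFun h a)
  have h2 := ((isMetricOn_metricComponents g x₀).posDef y hy).inv.dotProduct_mulVec_pos hl0
  simp only [star_trivial, dotProduct, Matrix.mulVec] at h2
  simp only [gradSq, grad] at h1
  refine h2.ne (h1.trans (Finset.sum_congr rfl fun i _ => mul_comm _ _))

/-- A positive solution `φ` on a compact manifold of the equation expressing harmonicity of the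
curvature of a warped product whose fibre has dimension `p` and Einstein constant `κ ≤ 0` is
constant. -/
theorem eq_of_divHess_eq [CompactSpace M] [ConnectedSpace M] (g : SmoothMetric n M) {φ : M → ℝ}
    (hφ : ContMDiff (𝓡 n) 𝓘(ℝ, ℝ) ∞ φ) (hpos : ∀ x, 0 < φ x) {p κ : ℝ} (hp : 1 ≤ p) (hκ : κ ≤ 0)
    (hE : ∀ x₀ : M, ∀ y ∈ (extChartAt (𝓡 n) x₀).target, ∀ f : EuclideanSpace ℝ (Fin n) → ℝ,
      f = φ ∘ (extChartAt (𝓡 n) x₀).symm → ∀ G,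
      G = metricComponents (𝓡 n) (stdBasis n) g.tensor x₀ → ∀ a,
      f y * divHess (stdBasis n) G f a y
        + (p - 2) * ∑ c, hessEndo (stdBasis n) G f a c y * pd (stdBasis n) c f y
        - (p - 1) * gradSq (stdBasis n) G f y * (pd (stdBasis n) a f y / f y)
        + pd (stdBasis n) a f y / f y * κ = 0) (x x' : M) :
    φ x = φ x' := by
  refine eq_of_gradNormSq_eq_zero g hφ (fun x => le_antisymm ?_ (gradNormSq_nonneg g hφ x)) x x'
  obtain ⟨xM, -, hxM⟩ := isCompact_univ.exists_isMaxOn Set.univ_nonempty hφ.continuous.continuousOn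
  have hmain : ∀ ε : ℝ, 0 < ε → gradNormSq g φ x ≤ ε * ((n + 1) * φ xM ^ 3) := by
    intro ε hε
    have hcont : Continuous fun z => gradNormSq g φ z + ε * φ z ^ 3 :=
      (continuous_gradNormSq g hφ).add (continuous_const.mul (hφ.continuous.pow 3))
    -- The local estimate holds only at this maximum `x₀`, which moves with `ε`; bounding `φ x₀` by
    -- the global maximum `φ xM` makes the final bound linear in `ε`.
    obtain ⟨x₀, -, hx₀⟩ := isCompact_univ.exists_isMaxOn Set.univ_nonempty hcont.continuousOn
    have hmax : ∀ z, gradNormSq g φ z + ε * φ z ^ 3 ≤ gradNormSq g φ x₀ + ε * φ x₀ ^ 3 :=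
      fun z => hx₀ (Set.mem_univ z)
    have hy := mem_extChartAt_target (I := 𝓡 n) x₀
    have hloc := (isMetricOn_metricComponents g x₀).gradSq_le_of_isLocalMax
      (contDiffOn_comp_chart_symm hφ x₀) hy (hpos _) hp hκ hε
      (hE x₀ _ hy _ rfl _ rfl) (by
        filter_upwards [(isOpen_extChartAt_target x₀).mem_nhds hy] with z hz
        simp only [← gradNormSq_chart_symm g hφ hz, ← gradNormSq_chart_symm g hφ hy,
          Function.comp_apply, extChartAt_to_inv]
        exact hmax _)
    rw [← gradNormSq_chart_symm g hφ hy, Function.comp_apply, extChartAt_to_inv,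
      Fintype.card_fin] at hloc
    have h1 : φ x₀ ^ 3 ≤ φ xM ^ 3 := pow_le_pow_left₀ (hpos _).le (hxM (Set.mem_univ x₀)) 3
    have h2 : 0 ≤ ε * φ x ^ 3 := mul_nonneg hε.le (pow_pos (hpos x) 3).le
    have h3 := hmax x
    have h4 : (n + 1 : ℝ) * ε * φ x₀ ^ 3 ≤ (n + 1) * ε * φ xM ^ 3 :=
      mul_le_mul_of_nonneg_left h1 (by positivity)
    linarith
  by_contra! hQ
  have hC : 0 < (n + 1) * φ xM ^ 3 := mul_pos (by positivity) (pow_pos (hpos xM) 3)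
  -- For this `ε` the bound is half of the quantity it bounds.
  have := hmain (gradNormSq g φ x / (2 * ((n + 1) * φ xM ^ 3))) (by positivity)
  rw [div_mul_eq_mul_div, le_div_iff₀ (by positivity)] at this
  nlinarith

end MaximumPrinciple

/-! ### The warped metric in product charts -/

section WarpedProduct

variable {m p : ℕ} {B S : Type*} [TopologicalSpace B] [ChartedSpace (EuclideanSpace ℝ (Fin m)) B]
  [IsManifold (𝓡 m) ∞ B] [TopologicalSpace S] [ChartedSpace (EuclideanSpace ℝ (Fin p)) S]
  [IsManifold (𝓡 p) ∞ S]

theorem mdifferentiableAt_prod_chart_symm {x : B × S}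
    {y : EuclideanSpace ℝ (Fin m) × EuclideanSpace ℝ (Fin p)}
    (hy : y ∈ (extChartAt ((𝓡 m).prod (𝓡 p)) x).target) :
    MDifferentiableAt 𝓘(ℝ, EuclideanSpace ℝ (Fin m) × EuclideanSpace ℝ (Fin p))
      ((𝓡 m).prod (𝓡 p)) (extChartAt ((𝓡 m).prod (𝓡 p)) x).symm y :=
  ((contMDiffOn_extChartAt_symm (n := ∞) x).contMDiffAt
    ((isOpen_extChartAt_target x).mem_nhds hy)).mdifferentiableAt (by simp)

theorem mfderiv_fst_prod_chart_symm {x : B × S}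
    {y : EuclideanSpace ℝ (Fin m) × EuclideanSpace ℝ (Fin p)}
    (hy : y ∈ (extChartAt ((𝓡 m).prod (𝓡 p)) x).target)
    (v : EuclideanSpace ℝ (Fin m) × EuclideanSpace ℝ (Fin p)) :
    mfderiv ((𝓡 m).prod (𝓡 p)) (𝓡 m) Prod.fst ((extChartAt ((𝓡 m).prod (𝓡 p)) x).symm y)
      (mfderiv 𝓘(ℝ, EuclideanSpace ℝ (Fin m) × EuclideanSpace ℝ (Fin p)) ((𝓡 m).prod (𝓡 p))
        (extChartAt ((𝓡 m).prod (𝓡 p)) x).symm y v)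
      = mfderiv 𝓘(ℝ, EuclideanSpace ℝ (Fin m)) (𝓡 m) (extChartAt (𝓡 m) x.1).symm y.1 v.1 := by
  have hy1 : y.1 ∈ (extChartAt (𝓡 m) x.1).target := by
    rw [extChartAt_prod] at hy; exact hy.1
  have h1 := mfderiv_comp y (mdifferentiableAt_fst (I := 𝓡 m) (I' := 𝓡 p))
    (mdifferentiableAt_prod_chart_symm hy)
  have h2 := mfderiv_comp (I := 𝓘(ℝ, EuclideanSpace ℝ (Fin m) × EuclideanSpace ℝ (Fin p)))
    (I' := 𝓘(ℝ, EuclideanSpace ℝ (Fin m))) y (f := Prod.fst) (mdifferentiableAt_chart_symm hy1)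
    differentiableAt_fst.mdifferentiableAt
  have h3 : (Prod.fst ∘ (extChartAt ((𝓡 m).prod (𝓡 p)) x).symm)
      = (extChartAt (𝓡 m) x.1).symm ∘ Prod.fst := by
    rw [extChartAt_prod]; rfl
  rw [h3, h2, mfderiv_eq_fderiv, fderiv_fst] at h1
  exact (congrArg (fun L => L v) h1).symm

theorem mfderiv_snd_prod_chart_symm {x : B × S}
    {y : EuclideanSpace ℝ (Fin m) × EuclideanSpace ℝ (Fin p)}
    (hy : y ∈ (extChartAt ((𝓡 m).prod (𝓡 p)) x).target)
    (v : EuclideanSpace ℝ (Fin m) × EuclideanSpace ℝ (Fin p)) :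
    mfderiv ((𝓡 m).prod (𝓡 p)) (𝓡 p) Prod.snd ((extChartAt ((𝓡 m).prod (𝓡 p)) x).symm y)
      (mfderiv 𝓘(ℝ, EuclideanSpace ℝ (Fin m) × EuclideanSpace ℝ (Fin p)) ((𝓡 m).prod (𝓡 p))
        (extChartAt ((𝓡 m).prod (𝓡 p)) x).symm y v)
      = mfderiv 𝓘(ℝ, EuclideanSpace ℝ (Fin p)) (𝓡 p) (extChartAt (𝓡 p) x.2).symm y.2 v.2 := by
  have hy2 : y.2 ∈ (extChartAt (𝓡 p) x.2).target := by
    rw [extChartAt_prod] at hy; exact hy.2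
  have h1 := mfderiv_comp y (mdifferentiableAt_snd (I := 𝓡 m) (I' := 𝓡 p))
    (mdifferentiableAt_prod_chart_symm hy)
  have h2 := mfderiv_comp (I := 𝓘(ℝ, EuclideanSpace ℝ (Fin m) × EuclideanSpace ℝ (Fin p)))
    (I' := 𝓘(ℝ, EuclideanSpace ℝ (Fin p))) y (f := Prod.snd) (mdifferentiableAt_chart_symm hy2)
    differentiableAt_snd.mdifferentiableAt
  have h3 : (Prod.snd ∘ (extChartAt ((𝓡 m).prod (𝓡 p)) x).symm)
      = (extChartAt (𝓡 p) x.2).symm ∘ Prod.snd := by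
    rw [extChartAt_prod]; rfl
  rw [h3, h2, mfderiv_eq_fderiv, fderiv_snd] at h1
  exact (congrArg (fun L => L v) h1).symm

theorem isWarpedOn_metricComponents (gB : SmoothMetric m B) (gS : SmoothMetric p S) {φ : B → ℝ}
    (hφ : ContMDiff (𝓡 m) 𝓘(ℝ, ℝ) ∞ φ) (hpos : ∀ x, 0 < φ x) (x : B × S) :
    IsWarpedOn (metricComponents (𝓡 m) (stdBasis m) gB.tensor x.1)
      (metricComponents (𝓡 p) (stdBasis p) gS.tensor x.2) (φ ∘ (extChartAt (𝓡 m) x.1).symm)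
      (extChartAt (𝓡 m) x.1).target (extChartAt (𝓡 p) x.2).target
      (metricComponents ((𝓡 m).prod (𝓡 p)) ((stdBasis m).prod (stdBasis p))
        (warpedMetric (𝓡 m) (𝓡 p) gB.tensor gS.tensor φ) x) where
  base := isMetricOn_metricComponents gB x.1
  fibre := isMetricOn_metricComponents gS x.2
  smooth := contDiffOn_comp_chart_symm hφ x.1
  pos _ _ := hpos _
  eq y hy := by
    have hy' : y ∈ (extChartAt ((𝓡 m).prod (𝓡 p)) x).target := by
      rw [extChartAt_prod]; exact hy
    have key : ∀ i j, metricComponents ((𝓡 m).prod (𝓡 p)) ((stdBasis m).prod (stdBasis p))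
        (warpedMetric (𝓡 m) (𝓡 p) gB.tensor gS.tensor φ) x y i j
        = gB.tensor ((extChartAt (𝓡 m) x.1).symm y.1)
          (mfderiv 𝓘(ℝ, EuclideanSpace ℝ (Fin m)) (𝓡 m) (extChartAt (𝓡 m) x.1).symm y.1
            (((stdBasis m).prod (stdBasis p) i).1))
          (mfderiv 𝓘(ℝ, EuclideanSpace ℝ (Fin m)) (𝓡 m) (extChartAt (𝓡 m) x.1).symm y.1
            (((stdBasis m).prod (stdBasis p) j).1))
        + φ ((extChartAt (𝓡 m) x.1).symm y.1) ^ 2 * gS.tensor ((extChartAt (𝓡 p) x.2).symm y.2)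
          (mfderiv 𝓘(ℝ, EuclideanSpace ℝ (Fin p)) (𝓡 p) (extChartAt (𝓡 p) x.2).symm y.2
            (((stdBasis m).prod (stdBasis p) i).2))
          (mfderiv 𝓘(ℝ, EuclideanSpace ℝ (Fin p)) (𝓡 p) (extChartAt (𝓡 p) x.2).symm y.2
            (((stdBasis m).prod (stdBasis p) j).2)) := by
      intro i j
      simp only [metricComponents, warpedMetric, Matrix.of_apply]
      rw [mfderiv_fst_prod_chart_symm hy', mfderiv_fst_prod_chart_symm hy',
        mfderiv_snd_prod_chart_symm hy', mfderiv_snd_prod_chart_symm hy']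
      rfl
    have hB0 : ∀ v, gB.tensor ((extChartAt (𝓡 m) x.1).symm y.1)
        (mfderiv 𝓘(ℝ, EuclideanSpace ℝ (Fin m)) (𝓡 m) (extChartAt (𝓡 m) x.1).symm y.1
          (0 : EuclideanSpace ℝ (Fin m))) v = 0 := fun v =>
      (congrArg (fun u => gB.tensor _ u v) (map_zero
        (mfderiv 𝓘(ℝ, EuclideanSpace ℝ (Fin m)) (𝓡 m)
          (extChartAt (𝓡 m) x.1).symm y.1))).trans
        (SmoothMetric.tensor_zero_left gB _ v)
    have hB0' : ∀ v, gB.tensor ((extChartAt (𝓡 m) x.1).symm y.1) v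
        (mfderiv 𝓘(ℝ, EuclideanSpace ℝ (Fin m)) (𝓡 m) (extChartAt (𝓡 m) x.1).symm y.1
          (0 : EuclideanSpace ℝ (Fin m))) = 0 := fun v =>
      (congrArg (fun u => gB.tensor _ v u) (map_zero
        (mfderiv 𝓘(ℝ, EuclideanSpace ℝ (Fin m)) (𝓡 m)
          (extChartAt (𝓡 m) x.1).symm y.1))).trans
        (SmoothMetric.tensor_zero_right gB _ v)
    have hS0 : ∀ v, gS.tensor ((extChartAt (𝓡 p) x.2).symm y.2)
        (mfderiv 𝓘(ℝ, EuclideanSpace ℝ (Fin p)) (𝓡 p) (extChartAt (𝓡 p) x.2).symm y.2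
          (0 : EuclideanSpace ℝ (Fin p))) v = 0 := fun v =>
      (congrArg (fun u => gS.tensor _ u v) (map_zero
        (mfderiv 𝓘(ℝ, EuclideanSpace ℝ (Fin p)) (𝓡 p)
          (extChartAt (𝓡 p) x.2).symm y.2))).trans
        (SmoothMetric.tensor_zero_left gS _ v)
    have hS0' : ∀ v, gS.tensor ((extChartAt (𝓡 p) x.2).symm y.2) v
        (mfderiv 𝓘(ℝ, EuclideanSpace ℝ (Fin p)) (𝓡 p) (extChartAt (𝓡 p) x.2).symm y.2
          (0 : EuclideanSpace ℝ (Fin p))) = 0 := fun v =>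
      (congrArg (fun u => gS.tensor _ v u) (map_zero
        (mfderiv 𝓘(ℝ, EuclideanSpace ℝ (Fin p)) (𝓡 p)
          (extChartAt (𝓡 p) x.2).symm y.2))).trans
        (SmoothMetric.tensor_zero_right gS _ v)
    ext i j
    rw [key]
    rcases i with a | i <;> rcases j with c | j <;>
    simp only [Module.Basis.prod_apply_inl_fst, Module.Basis.prod_apply_inl_snd,
      Module.Basis.prod_apply_inr_fst, Module.Basis.prod_apply_inr_snd, hB0, hB0', hS0,
      hS0', mul_zero, add_zero, zero_add, Matrix.fromBlocks_apply₁₁, Matrix.fromBlocks_apply₁₂,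
      Matrix.fromBlocks_apply₂₁, Matrix.fromBlocks_apply₂₂, Matrix.smul_apply, Matrix.zero_apply]
    · rfl
    · rfl

end WarpedProduct

/-! ### Counting the eigenvalues of the Ricci endomorphism -/

/-- A block lower triangular matrix whose lower right block is scalar has at most one more
eigenvalue than its upper left block has rows. -/
theorem Matrix.ncard_eigenvalues_fromBlocks_le {ι κ : Type*} [Fintype ι] [Fintype κ]
    [DecidableEq ι] [DecidableEq κ] (A : Matrix ι ι ℝ) (C : Matrix κ ι ℝ) (μ : ℝ) :
    {t | Module.End.HasEigenvalue
      (Matrix.toLin' (Matrix.fromBlocks A 0 C (μ • (1 : Matrix κ κ ℝ)))) t}.ncard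
      ≤ Fintype.card ι + 1 := by
  have hsub : {t | Module.End.HasEigenvalue
      (Matrix.toLin' (Matrix.fromBlocks A 0 C (μ • (1 : Matrix κ κ ℝ)))) t}
      ⊆ insert μ (A.charpoly.roots.toFinset : Set ℝ) := by
    intro t ht
    obtain ⟨v, hv⟩ := ht.exists_hasEigenvector
    have h1 := hv.apply_eq_smul
    rw [Matrix.toLin'_apply, Matrix.fromBlocks_mulVec] at h1
    have hl : A.mulVec (v ∘ Sum.inl) = t • (v ∘ Sum.inl) := by
      funext a
      simpa using congrFun h1 (Sum.inl a)
    -- An eigenvector with zero base part lives in the scalar block, so `t = μ`; otherwise its base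
    -- part is an eigenvector of `A`.
    by_cases hz : v ∘ Sum.inl = 0
    · left
      obtain ⟨i, hi⟩ : ∃ i, v (Sum.inr i) ≠ 0 := by
        by_contra! h
        exact hv.2 (funext fun k => by
          rcases k with a | i
          · exact congrFun hz a
          · exact h i)
      have := congrFun h1 (Sum.inr i)
      simp only [hz, Sum.elim_inr, Matrix.mulVec_zero, zero_add, Matrix.smul_mulVec,
        Matrix.one_mulVec, Pi.smul_apply, Function.comp_apply, smul_eq_mul] at this
      exact (mul_right_cancel₀ hi this).symm
    · right
      have hA : Module.End.HasEigenvalue (Matrix.toLin' A) t :=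
        Module.End.hasEigenvalue_of_hasEigenvector (x := v ∘ Sum.inl)
          ⟨Module.End.mem_eigenspace_iff.2 (by rw [Matrix.toLin'_apply, hl]), hz⟩
      have h2 := (Module.End.hasEigenvalue_iff_isRoot_charpoly _ _).1 hA
      rw [Matrix.charpoly_toLin'] at h2
      simpa using (Polynomial.mem_roots A.charpoly_monic.ne_zero).2 h2
  calc _ ≤ (insert μ (A.charpoly.roots.toFinset : Set ℝ)).ncard :=
        Set.ncard_le_ncard hsub ((Finset.finite_toSet _).insert μ)
    _ ≤ (A.charpoly.roots.toFinset : Set ℝ).ncard + 1 := Set.ncard_insert_le _ _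
    _ ≤ Fintype.card ι + 1 := by
        rw [Set.ncard_coe_finset]
        gcongr
        exact (Multiset.toFinset_card_le _).trans
          ((Polynomial.card_roots' _).trans A.charpoly_natDegree_eq_dim.le)

/-- On the fibre block the Ricci tensor and the metric are both multiples of `N`, so raising an
index gives a scalar matrix. Block triangularity is enough for the eigenvalue count, so `C` need not
be computed. -/
theorem RiemCoord.IsWarpedOn.ricciEndo_eq_fromBlocks {E E' : Type*} [NormedAddCommGroup E]
    [NormedSpace ℝ E] [NormedAddCommGroup E'] [NormedSpace ℝ E'] {ι κ : Type*} [Fintype ι]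
    [Fintype κ] [DecidableEq ι] [DecidableEq κ] {b : Module.Basis ι ℝ E} {b' : Module.Basis κ ℝ E'}
    {G : E → Matrix ι ι ℝ} {N : E' → Matrix κ κ ℝ} {f : E → ℝ} {U : Set E} {V : Set E'}
    {W : E × E' → Matrix (ι ⊕ κ) (ι ⊕ κ) ℝ} {y : E × E'} (h : IsWarpedOn G N f U V W)
    (hy : y ∈ U ×ˢ V) {c : ℝ} (hc : ∀ i j, ricci b' N i j y.2 = c * N y.2 i j) :
    ∃ (A : Matrix ι ι ℝ) (C : Matrix κ ι ℝ) (μ : ℝ),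
      ricciEndo (b.prod b') W y = Matrix.fromBlocks A 0 C (μ • (1 : Matrix κ κ ℝ)) := by
  set R : Matrix (ι ⊕ κ) (ι ⊕ κ) ℝ := Matrix.of fun l j => ricci (b.prod b') W l j y with hR
  obtain ⟨ν, hν⟩ : ∃ ν : ℝ, R.toBlocks₂₂ = ν • N y.2 := by
    refine ⟨c - (f y.1 * ∑ a, hessEndo b G f a a y.1
      + (Fintype.card κ - 1) * gradSq b G f y.1), ?_⟩
    ext i j
    simp only [hR, Matrix.toBlocks₂₂, Matrix.of_apply, h.ricci_rr hy, hc, Matrix.smul_apply,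
      smul_eq_mul]
    ring
  have h12 : R.toBlocks₁₂ = 0 := by
    ext a j
    simp [hR, Matrix.toBlocks₁₂, h.ricci_lr hy]
  refine ⟨(G y.1)⁻¹ * R.toBlocks₁₁, ((f y.1 ^ 2)⁻¹ • (N y.2)⁻¹) * R.toBlocks₂₁,
    ν * (f y.1 ^ 2)⁻¹, ?_⟩
  rw [ricciEndo, ← hR, ← Matrix.fromBlocks_toBlocks R, h.inv_eq hy, Matrix.fromBlocks_multiply,
    h12, hν]
  simp [h.fibre.inv_mul hy.2, smul_smul]

end

/-! ### Proof of the theorem -/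

open RiemCoord

/-- A warped product `(B × S, gB + φ² gS)` with compact base `B` of dimension `m`, fibre `S` of
dimension `p ≥ 1`, nonconstant warping function `φ` and harmonic curvature. -/
theorem theorem1p3 (m p : ℕ) (hp : 1 ≤ p)
    (B : Type*) [TopologicalSpace B] [T2Space B] [CompactSpace B] [ConnectedSpace B]
    [ChartedSpace (EuclideanSpace ℝ (Fin m)) B] [IsManifold (𝓡 m) ∞ B]
    (S : Type*) [TopologicalSpace S] [T2Space S] [SecondCountableTopology S] [ConnectedSpace S]
    [ChartedSpace (EuclideanSpace ℝ (Fin p)) S] [IsManifold (𝓡 p) ∞ S]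
    (gB : SmoothMetric m B) (gS : SmoothMetric p S)
    (φ : B → ℝ) (hφ : ContMDiff (𝓡 m) 𝓘(ℝ, ℝ) ∞ φ) (hφpos : ∀ x, 0 < φ x)
    (hφnc : ∃ x x' : B, φ x ≠ φ x')
    (hharm : HasHarmonicCurvature ((𝓡 m).prod (𝓡 p)) ((stdBasis m).prod (stdBasis p))
      (warpedMetric (𝓡 m) (𝓡 p) gB.tensor gS.tensor φ)) :
    (∃ κ : ℝ, IsEinsteinWith (𝓡 p) (stdBasis p) gS.tensor κ) ∧
    (∀ κ : ℝ, IsEinsteinWith (𝓡 p) (stdBasis p) gS.tensor κ → 0 < κ) ∧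
    1 < p ∧
    (∀ x : B × S, (ricciEigenvalues ((𝓡 m).prod (𝓡 p)) ((stdBasis m).prod (stdBasis p))
      (warpedMetric (𝓡 m) (𝓡 p) gB.tensor gS.tensor φ) x).ncard ≠ m + p) := by
  set f : B → EuclideanSpace ℝ (Fin m) → ℝ := fun x₀ => φ ∘ (extChartAt (𝓡 m) x₀).symm with hf
  set G := metricComponents (𝓡 m) (stdBasis m) gB.tensor with hG
  set N := metricComponents (𝓡 p) (stdBasis p) gS.tensor with hN
  have hw := isWarpedOn_metricComponents gB gS hφ hφpos
  have hdiv : ∀ x₀ : B, ∀ u ∈ (extChartAt (𝓡 m) x₀).target, ∀ s₀ : S,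
      ∀ w ∈ (extChartAt (𝓡 p) s₀).target, ∀ a i j,
      (f x₀ u * divHess (stdBasis m) (G x₀) (f x₀) a u
          + (p - 2) * ∑ c, hessEndo (stdBasis m) (G x₀) (f x₀) a c u * pd (stdBasis m) c (f x₀) u
          - (p - 1) * gradSq (stdBasis m) (G x₀) (f x₀) u
            * (pd (stdBasis m) a (f x₀) u / f x₀ u)) * N s₀ w i j
        + pd (stdBasis m) a (f x₀) u / f x₀ u * ricci (stdBasis p) (N s₀) i j w = 0 := by
    intro x₀ u hu s₀ w hws a i j
    have h1 := (hw (x₀, s₀)).divCurvature_lrr (b := stdBasis m) (b' := stdBasis p)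
      (y := (u, w)) ⟨hu, hws⟩ a i j
    rw [hharm (x₀, s₀) (u, w) (by rw [extChartAt_prod]; exact ⟨hu, hws⟩), Fintype.card_fin] at h1
    exact h1.symm
  obtain ⟨κ, hκ⟩ : ∃ κ : ℝ, IsEinsteinWith (𝓡 p) (stdBasis p) gS.tensor κ := by
    obtain ⟨x₀, u, hu, a, ha⟩ := exists_pd_ne_zero hφ hφnc
    have hfu : f x₀ u ≠ 0 := (hφpos _).ne'
    have hq : pd (stdBasis m) a (f x₀) u / f x₀ u ≠ 0 := div_ne_zero ha hfu
    -- The base point `u` and the index `a` stay fixed while the fibre point varies, so this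
    -- quotient is a genuine constant.
    refine ⟨-(f x₀ u * divHess (stdBasis m) (G x₀) (f x₀) a u
          + (p - 2) * ∑ c, hessEndo (stdBasis m) (G x₀) (f x₀) a c u * pd (stdBasis m) c (f x₀) u
          - (p - 1) * gradSq (stdBasis m) (G x₀) (f x₀) u
            * (pd (stdBasis m) a (f x₀) u / f x₀ u)) / (pd (stdBasis m) a (f x₀) u / f x₀ u),
      fun s₀ w hws i j => ?_⟩
    have h1 := hdiv x₀ u hu s₀ w hws a i j
    rw [div_mul_eq_mul_div, eq_div_iff hq]
    linear_combination h1
  have hpos : ∀ κ : ℝ, IsEinsteinWith (𝓡 p) (stdBasis p) gS.tensor κ → 0 < κ := by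
    intro κ hκ
    by_contra! hκ0
    obtain ⟨x, x', hne⟩ := hφnc
    obtain ⟨s₀⟩ : Nonempty S := inferInstance
    refine hne (eq_of_divHess_eq gB hφ hφpos (p := p) (by exact_mod_cast hp) hκ0 ?_ x x')
    rintro x₀ u hu _ rfl _ rfl a
    have hws := mem_extChartAt_target (I := 𝓡 p) s₀
    -- One diagonal fibre entry suffices: it exists because `p ≥ 1`, and its metric component is
    -- positive and can be cancelled.
    have h1 := hdiv x₀ u hu s₀ _ hws a ⟨0, hp⟩ ⟨0, hp⟩
    have hNpos : 0 < N s₀ (extChartAt (𝓡 p) s₀ s₀) ⟨0, hp⟩ ⟨0, hp⟩ :=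
      ((isMetricOn_metricComponents gS s₀).posDef _ hws).diag_pos
    rw [hκ s₀ _ hws, ← mul_assoc, ← add_mul] at h1
    exact (mul_eq_zero.1 h1).resolve_right hNpos.ne'
  have hp1 : 1 < p := by
    by_contra! hle
    obtain rfl : p = 1 := le_antisymm hle hp
    exact lt_irrefl _ (hpos 0 fun s₀ w _ i j => by
      rw [ricci_eq_zero_of_subsingleton, zero_mul])
  refine ⟨⟨κ, hκ⟩, hpos, hp1, fun x => ?_⟩
  have hy : extChartAt ((𝓡 m).prod (𝓡 p)) x x
      ∈ (extChartAt (𝓡 m) x.1).target ×ˢ (extChartAt (𝓡 p) x.2).target := by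
    rw [extChartAt_prod]
    exact ⟨mem_extChartAt_target x.1, mem_extChartAt_target x.2⟩
  obtain ⟨A, C, μ, hA⟩ := (hw x).ricciEndo_eq_fromBlocks (b := stdBasis m) (b' := stdBasis p) hy
    (hκ x.2 _ hy.2)
  have hle := Matrix.ncard_eigenvalues_fromBlocks_le A C μ
  rw [← hA, Fintype.card_fin] at hle
  intro heq
  have : m + p ≤ m + 1 := heq ▸ hle
  omega
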